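/- Consider the following wireless network in the plane $\mathbb R^2$. Let $\lambda_s,\lambda_{ap},\lambda_e^s,P_s,P_{ap}>0$, $0<\rho_s<1$, $0<\rho_{ap}<1$, $\alpha>2$ and $\mu=P_{ap}/P_s$. A typical sensor, at the origin, transmits with power $P_s$ to the nearest point (the typical access point) of a homogeneous Poisson point process of intensity $\lambda_{ap}(1-\rho_{ap})$, the access points available to receive. The eavesdroppers $e_k$ form a homogeneous Poisson point process $\Phi_{s,e}$ of intensity $\lambda_e^s$. The interferers that a receiver (the typical access point or an eavesdropper) hears are the other active sensors, a homogeneous Poisson point process $\Phi_{s,a}$ of intensity $\lambda_s\rho_s$ with transmit power $P_s$, and the active access points, a homogeneous Poisson point process $\Phi_{ap,a}$ of intensity $\lambda_{ap}\rho_{ap}$ with transmit power $P_{ap}$. The interference at different receivers is taken to be independent, i.e. each receiver sees its own independent realization of $\Phi_{s,a}$ and $\Phi_{ap,a}$. All nodes have a single antenna, all fading coefficients are i.i.d. circularly symmetric complex Gaussian with mean $0$ and variance $1$ (Rayleigh fading), the path loss at distance $d$ is $d^{-\alpha}$, noise is neglected (interference-limited case), and all the point processes and fading coefficients are independent. Let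 $\gamma_{ap}$ be the signal-to-interference ratio at the typical access point and $\gamma_{s,e}$ the largest signal-to-interference ratio of the typical sensor's signal over all eavesdroppers: $$\gamma=\frac{|h_0|^2d_0^{-\alpha}}{\sum_{i\in\Phi_{s,a}}|h_i|^2d_i^{-\alpha}+\mu\sum_{j\in\Phi_{ap,a}}|h_j|^2d_j^{-\alpha}}$$ at each receiver, where $h_0,h_i,h_j$ and $d_0,d_i,d_j$ are the fading coefficients and the distances from the typical sensor and from the interferers to that receiver. Both are almost surely finite; let $F_{\gamma_{ap}},F_{\gamma_{s,e}}$ be their cumulative distribution functions. Then the average secrecy rate between the sensor and the access point, $$\bar C_s^{ap}=\mathbb E\Big[\max\{\log_2(1+\gamma_{ap})-\log_2(1+\gamma_{s,e}),0\}\Big],$$ is finite and $$\bar C_s^{ap}=\frac1{\ln 2}\int_0^\infty\frac{F_{\gamma_{s,e}}(x)}{1+x}\bigl(1-F_{\gamma_{ap}}(x)\bigr)\,dx=\frac{\pi\lambda_{ap}(1-\rho_{ap})}{\ln 2}\int_0^\infty \frac{\exp\{-\pi\lambda_e^s/(\Lambda_1x^{2/\alpha})\}}{(1+x)\bigl(\Lambda_1x^{2/\alpha}+\pi\lambda_{ap}(1-\rho_{ap})\bigr)}\,dx,$$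 where the last integral converges and $\Lambda_1=(\lambda_s\rho_s+\lambda_{ap}\rho_{ap}\mu^{2/\alpha})\,\pi\,\Gamma(1+2/\alpha)\,\Gamma(1-2/\alpha)$. -/

import Mathlib

open MeasureTheory ProbabilityTheory

/-- The Euclidean plane, in which all nodes of the network are located. -/
abbrev Plane : Type := EuclideanSpace ℝ (Fin 2)

/-- The circularly symmetric complex Gaussian law with mean zero and unit variance:
independent real and imaginary parts, each centred Gaussian with variance `1 / 2`. -/
noncomputable def stdComplexGaussian : Measure ℂ :=
  ((gaussianReal 0 (1 / 2)).prod (gaussianReal 0 (1 / 2))).map Complex.measurableEquivRealProd.symm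

/-- The number of points (with multiplicity) of the configuration `x` that lie in `B`. -/
noncomputable def pointCount (x : ℕ → Plane) (B : Set Plane) : ℕ∞ :=
  {i : ℕ | x i ∈ B}.encard

/-- `X` is a measurable enumeration of the points of a homogeneous Poisson point process in the
plane with intensity `lam`. (For `lam > 0` such a process almost surely has infinitely many
points, so that they can be enumerated by `ℕ`.) The number of points in a Borel set `B` of finite
area is Poisson with mean `lam * area B`, and the numbers of points in pairwise disjoint Borel sets
of finite area are independent. The order of the enumeration is arbitrary. -/
structure IsHPPP {Ω : Type*} [MeasurableSpace Ω] (P : Measure Ω)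
    (X : Ω → ℕ → Plane) (lam : ℝ) : Prop where
  measurable : Measurable X
  count_law : ∀ B : Set Plane, MeasurableSet B → volume B ≠ ⊤ → ∀ n : ℕ,
    P {ω | pointCount (X ω) B = n} = poissonMeasure (lam * (volume B).toReal).toNNReal {n}
  count_indep : ∀ (n : ℕ) (B : Fin n → Set Plane), (∀ i, MeasurableSet (B i)) →
    (∀ i, volume (B i) ≠ ⊤) → Pairwise (fun i j => Disjoint (B i) (B j)) →
    iIndepFun (fun i ω => pointCount (X ω) (B i)) P

/-- The receivers that hear the typical sensor: its access point, and the eavesdroppers,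
which are labelled by the enumeration of their point process. -/
inductive Receiver : Type
  | ap : Receiver
  | eve (k : ℕ) : Receiver

/-- The point processes of the network. The active sensors (other than the typical one) and the
active access points are those that a given receiver hears: every receiver has its own
realization of the interfering nodes. -/
inductive Proc : Type
  | idleAP : Proc
  | eavesdropper : Proc
  | activeSensor (r : Receiver) : Proc
  | activeAP (r : Receiver) : Proc

/-- The scalar fading coefficients; `M` is the number of antennas of an access point.
* `sensorAP m`: typical sensor to antenna `m` of its access point;
* `interfSensorAP i m`: interfering sensor `i` to antenna `m` of that access point;
* `interfAPAP j m n`: antenna `n` of interfering access point `j` to antenna `m` of that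
  access point;
* `sensorEve k`: typical sensor to eavesdropper `k`;
* `interfSensorEve k i`: interfering sensor `i` to eavesdropper `k`;
* `interfAPEve k j n`: antenna `n` of interfering access point `j` to eavesdropper `k`;
* `apSink r j n`: antenna `n` of the access point `j` that interferes at receiver `r`, to the sink
  which that access point serves. -/
inductive Channel (M : ℕ) : Type
  | sensorAP (m : Fin M) : Channel M
  | interfSensorAP (i : ℕ) (m : Fin M) : Channel M
  | interfAPAP (j : ℕ) (m n : Fin M) : Channel M
  | sensorEve (k : ℕ) : Channel M
  | interfSensorEve (k i : ℕ) : Channel M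
  | interfAPEve (k j : ℕ) (n : Fin M) : Channel M
  | apSink (r : Receiver) (j : ℕ) (n : Fin M) : Channel M

/-- The intensities of the point processes. A sensor is active with probability `rhoS`, an access
point with probability `rhoAP`; the access points that are not active are available to receive. -/
def intensity (lamS rhoS lamAP rhoAP lamE : ℝ) : Proc → ℝ
  | Proc.idleAP => lamAP * (1 - rhoAP)
  | Proc.eavesdropper => lamE
  | Proc.activeSensor _ => lamS * rhoS
  | Proc.activeAP _ => lamAP * rhoAP

/-- The random network: homogeneous Poisson point processes `X` and Rayleigh fading coefficients
`h`, all of them independent. -/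
structure IsSensorNetwork {Ω : Type*} [MeasurableSpace Ω] (P : Measure Ω) (M : ℕ)
    (lamS rhoS lamAP rhoAP lamE : ℝ)
    (X : Proc → Ω → ℕ → Plane) (h : Channel M → Ω → ℂ) : Prop where
  hppp : ∀ p, IsHPPP P (X p) (intensity lamS rhoS lamAP rhoAP lamE p)
  fading_measurable : ∀ c, Measurable (h c)
  fading_law : ∀ c, P.map (h c) = stdComplexGaussian
  indep_locations : iIndepFun X P
  indep_fading : iIndepFun h P
  indep_locations_fading : IndepFun (fun ω p => X p ω) (fun ω c => h c ω) P

open Classical in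
/-- The point of the configuration `x` that is nearest to the origin (the first one in the
enumeration in case of a tie). -/
noncomputable def nearestPoint (x : ℕ → Plane) : Plane :=
  if hx : ∃ i, ∀ j, ‖x i‖ ≤ ‖x j‖ then x (Nat.find hx) else x 0

/-- The path loss `|y - z| ^ (-alpha)`. -/
noncomputable def pathLoss (alpha : ℝ) (y z : Plane) : ENNReal :=
  ENNReal.ofReal (dist y z) ^ (-alpha)

/-- The unit vector `u / ‖u‖`, with the Euclidean norm. -/
noncomputable def unitVec {M : ℕ} (u : Fin M → ℂ) : Fin M → ℂ :=
  fun m => u m / (‖WithLp.toLp 2 u‖ : ℂ)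

/-- The power `|z|²` of a complex amplitude. -/
noncomputable def power (z : ℂ) : ENNReal := ENNReal.ofReal (‖z‖ ^ 2)

section Network

variable {Ω : Type*} {M : ℕ} (alpha mu noise : ℝ)
  (X : Proc → Ω → ℕ → Plane) (h : Channel M → Ω → ℂ)

/-- The typical sensor is at the origin. Its access point is the nearest one that is available to
receive. -/
noncomputable def apPosition (ω : Ω) : Plane := nearestPoint (X Proc.idleAP ω)

/-- The position of eavesdropper `k`. -/
def evePosition (k : ℕ) (ω : Ω) : Plane := X Proc.eavesdropper ω k

/-- The channel vector from the typical sensor to its access point. -/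
def sensorVec (ω : Ω) : Fin M → ℂ := fun m => h (Channel.sensorAP m) ω

/-- The channel vector from the access point `j`, which interferes at receiver `r`, to its own sink;
it determines the beamformer of that access point. -/
def sinkVec (r : Receiver) (j : ℕ) (ω : Ω) : Fin M → ℂ := fun n => h (Channel.apSink r j n) ω

/-- Interference of the active sensors at the typical access point, after maximal-ratio
combining. -/
noncomputable def interfSensorsAP (ω : Ω) : ENNReal :=
  ∑' i : ℕ, power (star (unitVec (sensorVec h ω)) ⬝ᵥ fun m => h (Channel.interfSensorAP i m) ω) *
    pathLoss alpha (X (Proc.activeSensor Receiver.ap) ω i) (apPosition X ω)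

/-- Interference of the active access points, which use maximal-ratio transmission, at the typical
access point, after maximal-ratio combining. -/
noncomputable def interfAPsAP (ω : Ω) : ENNReal :=
  ENNReal.ofReal mu * ∑' j : ℕ,
    power (star (unitVec (sensorVec h ω)) ⬝ᵥ
      (Matrix.mulVec (Matrix.of fun m n => h (Channel.interfAPAP j m n) ω)
        (star (unitVec (sinkVec h Receiver.ap j ω))))) *
    pathLoss alpha (X (Proc.activeAP Receiver.ap) ω j) (apPosition X ω)

/-- The SINR at the typical access point; `noise` is the ratio of the noise power to the transmit
power of a sensor, `mu` the ratio of the transmit powers of an access point and of a sensor. -/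
noncomputable def sinrAP (ω : Ω) : ENNReal :=
  (ENNReal.ofReal (‖WithLp.toLp 2 (sensorVec h ω)‖ ^ 2) * pathLoss alpha 0 (apPosition X ω)) /
    (interfSensorsAP alpha X h ω + interfAPsAP alpha mu X h ω + ENNReal.ofReal noise)

/-- Interference of the active sensors at eavesdropper `k`. -/
noncomputable def interfSensorsEve (k : ℕ) (ω : Ω) : ENNReal :=
  ∑' i : ℕ, power (h (Channel.interfSensorEve k i) ω) *
    pathLoss alpha (X (Proc.activeSensor (Receiver.eve k)) ω i) (evePosition X k ω)

/-- Interference of the active access points, which use maximal-ratio transmission, at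
eavesdropper `k`. -/
noncomputable def interfAPsEve (k : ℕ) (ω : Ω) : ENNReal :=
  ∑' j : ℕ, ENNReal.ofReal mu *
    power ((fun n => h (Channel.interfAPEve k j n) ω) ⬝ᵥ
      star (unitVec (sinkVec h (Receiver.eve k) j ω))) *
    pathLoss alpha (X (Proc.activeAP (Receiver.eve k)) ω j) (evePosition X k ω)

/-- The SINR at eavesdropper `k`. -/
noncomputable def sinrEveAt (k : ℕ) (ω : Ω) : ENNReal :=
  (power (h (Channel.sensorEve k) ω) * pathLoss alpha 0 (evePosition X k ω)) /
    (interfSensorsEve alpha X h k ω + interfAPsEve alpha mu X h k ω + ENNReal.ofReal noise)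

/-- The SINR at the most detrimental eavesdropper. -/
noncomputable def sinrEve (ω : Ω) : ENNReal := ⨆ k : ℕ, sinrEveAt alpha mu noise X h k ω

end Network

/-- The capacity `log₂ (1 + γ)` of a channel with SINR `γ`. -/
noncomputable def capacity (γ : ENNReal) : ℝ := Real.logb 2 (1 + γ.toReal)

/-- The instantaneous secrecy rate `[C_ap - C_{s,e}]⁺` of the link from the typical sensor to its
access point. -/
noncomputable def secrecyRate {Ω : Type*} {M : ℕ} (alpha mu noise : ℝ)
    (X : Proc → Ω → ℕ → Plane) (h : Channel M → Ω → ℂ) (ω : Ω) : ℝ :=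
  max (capacity (sinrAP alpha mu noise X h ω) - capacity (sinrEve alpha mu noise X h ω)) 0

/-- The cumulative distribution function of a `[0, ∞]`-valued random variable, at a real number. -/
noncomputable def sinrCDF {Ω : Type*} [MeasurableSpace Ω] (P : Measure Ω) (γ : Ω → ENNReal)
    (x : ℝ) : ℝ :=
  P.real {ω | γ ω ≤ ENNReal.ofReal x}

/-- The constant `Λ₁`. -/
noncomputable def Lambda1 (lamS rhoS lamAP rhoAP mu alpha : ℝ) : ℝ :=
  (lamS * rhoS + lamAP * rhoAP * mu ^ (2 / alpha)) * Real.pi *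
    Real.Gamma (1 + 2 / alpha) * Real.Gamma (1 - 2 / alpha)

/-- The integrand of the closed form of the average secrecy rate. -/
noncomputable def secrecyIntegrand (lamS rhoS lamAP rhoAP lamE mu alpha x : ℝ) : ℝ :=
  Real.exp (-(Real.pi * lamE / (Lambda1 lamS rhoS lamAP rhoAP mu alpha * x ^ (2 / alpha)))) /
    ((1 + x) * (Lambda1 lamS rhoS lamAP rhoAP mu alpha * x ^ (2 / alpha) +
      Real.pi * lamAP * (1 - rhoAP)))

/-! For 0 ≤ e, a < ∞ the positive part of log(1 + a) - log(1 + e) is the integral of 1/(1 + x) over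
[e, a) (`ofReal_log_one_add_sub_log`). By Tonelli, the expected rate is the integral of P(γ_e ≤ x <
γ_ap)/(1 + x), and the two ratios are independent because they are built from disjoint groups of
random elements. It remains to find two distribution functions.

The power of a Rayleigh coefficient is exponential with mean one. Hence, for a receiver at distance
r from the sensor, the probability that its ratio exceeds x is the Laplace transform of the
interference at x r^α. The Laplace functional `IsHPPP.laplace`, the transform 1/(1 + s) of each
fading power and a Gamma integral turn it into exp(-c r²) with c = Λ₁ x^(2/α)
(`IsLink.prob_lt_linkSIR`).

For the access point, r² is the squared distance to the nearest point, exponential with rate K =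
πλ_ap(1 - ρ_ap) by the void probabilities; averaging gives K/(c + K) (`prob_lt_sirAP`). For the
eavesdroppers, given their positions, the links are independent, so no ratio exceeds x with
probability ∏(1 - exp(-c|e_k|²)). The Laplace functional averages this product to exp(-λ_e ∫
exp(-c|y|²) dy) = exp(-πλ_e/c) (`prob_sirEve_le`).

With a single antenna, combining and beamforming only multiply by phases, so almost surely they
leave every power unchanged. All ratios and sums are kept in [0, ∞], which postpones finiteness
questions to the end. -/

open Filter Topology
open scoped ENNReal NNReal

/-! ### Laplace transforms of variables with values in [0, ∞] -/

/-- `exp (-t)` for `t ∈ [0, ∞]`. -/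
noncomputable def expNeg (t : ℝ≥0∞) : ℝ≥0∞ := EReal.exp (-(t : EReal))

/-- `-log q` for `q ∈ [0, 1]`. -/
noncomputable def negLog (q : ℝ≥0∞) : ℝ≥0∞ := (-(ENNReal.log q)).toENNReal

@[simp] lemma expNeg_zero : expNeg 0 = 1 := by simp [expNeg]

@[simp] lemma expNeg_top : expNeg ⊤ = 0 := by simp [expNeg]

lemma expNeg_ofReal {t : ℝ} (ht : 0 ≤ t) :
    expNeg (ENNReal.ofReal t) = ENNReal.ofReal (Real.exp (-t)) := by
  rw [expNeg, EReal.coe_ennreal_ofReal, max_eq_left ht, ← EReal.coe_neg, EReal.exp_coe]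

lemma expNeg_le_one (t : ℝ≥0∞) : expNeg t ≤ 1 := by
  simpa [expNeg] using EReal.coe_ennreal_nonneg t

lemma expNeg_add (s t : ℝ≥0∞) : expNeg (s + t) = expNeg s * expNeg t := by
  rw [expNeg, expNeg, expNeg, ← EReal.exp_add, EReal.coe_ennreal_add, EReal.neg_add, sub_eq_add_neg]
  · exact Or.inl (EReal.coe_ennreal_ne_bot _)
  · exact Or.inr (EReal.coe_ennreal_ne_bot _)

lemma continuous_expNeg : Continuous expNeg :=
  ENNReal.continuous_exp.comp (continuous_neg.comp continuous_coe_ennreal_ereal)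

@[fun_prop]
lemma measurable_expNeg : Measurable expNeg := continuous_expNeg.measurable

lemma antitone_expNeg : Antitone expNeg := fun s t hst => by
  simpa [expNeg] using hst

@[fun_prop]
lemma measurable_negLog : Measurable negLog :=
  (ENNReal.measurable_log.neg).ereal_toENNReal

/-- This turns infinite products of numbers in [0, 1] into `expNeg` of a sum, the form that a
Laplace functional accepts. The value q = 0 is covered, with logarithm -∞. -/
lemma expNeg_negLog {q : ℝ≥0∞} (hq : q ≤ 1) : expNeg (negLog q) = q := by
  rw [expNeg, negLog, EReal.coe_toENNReal (by simpa using hq), neg_neg, ENNReal.exp_log]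

lemma expNeg_sum {ι : Type*} (s : Finset ι) (f : ι → ℝ≥0∞) :
    expNeg (∑ i ∈ s, f i) = ∏ i ∈ s, expNeg (f i) := by
  classical
  induction s using Finset.induction_on with
  | empty => simp
  | insert a s ha ih => rw [Finset.sum_insert ha, Finset.prod_insert ha, expNeg_add, ih]

lemma tendsto_expNeg_sum_range (f : ℕ → ℝ≥0∞) :
    Tendsto (fun n => expNeg (∑ i ∈ Finset.range n, f i)) atTop (𝓝 (expNeg (∑' i, f i))) :=
  (continuous_expNeg.tendsto _).comp ENNReal.summable.hasSum.tendsto_sum_nat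

lemma lintegral_expNeg_le_one {Ω : Type*} [MeasurableSpace Ω] {P : Measure Ω}
    [IsProbabilityMeasure P] (W : Ω → ℝ≥0∞) : ∫⁻ ω, expNeg (W ω) ∂P ≤ 1 :=
  (lintegral_mono fun ω => expNeg_le_one (W ω)).trans (by simp)

/-- The constant 1 dominates, so no integrability of the variables is needed and the limit may be
infinite. -/
lemma tendsto_lintegral_expNeg {Ω : Type*} [MeasurableSpace Ω] {P : Measure Ω}
    [IsProbabilityMeasure P] {W : ℕ → Ω → ℝ≥0∞} {V : Ω → ℝ≥0∞} (hW : ∀ n, Measurable (W n))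
    (h : ∀ᵐ ω ∂P, Tendsto (fun n => W n ω) atTop (𝓝 (V ω))) :
    Tendsto (fun n => ∫⁻ ω, expNeg (W n ω) ∂P) atTop (𝓝 (∫⁻ ω, expNeg (V ω) ∂P)) := by
  refine tendsto_lintegral_of_dominated_convergence (fun _ => 1)
    (fun n => measurable_expNeg.comp (hW n)) (fun n => .of_forall fun ω => expNeg_le_one _)
    (by simp) ?_
  filter_upwards [h] with ω hω using (continuous_expNeg.tendsto _).comp hω

/-- Laplace transform of the sum of a sequence of independent `[0, ∞]`-valued variables. -/
lemma lintegral_expNeg_tsum {Ω : Type*} [MeasurableSpace Ω] {P : Measure Ω}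
    [IsProbabilityMeasure P] {W : ℕ → Ω → ℝ≥0∞} (hW : ∀ n, Measurable (W n))
    (hind : ∀ n, IndepFun (fun ω => ∑ i ∈ Finset.range n, W i ω) (W n) P) :
    ∫⁻ ω, expNeg (∑' i, W i ω) ∂P = expNeg (∑' i, negLog (∫⁻ ω, expNeg (W i ω) ∂P)) := by
  -- Independence of each term from the preceding partial sum is all that the induction uses; the
  -- infinite sum is then a limit on both sides.
  have hfin : ∀ n, ∫⁻ ω, expNeg (∑ i ∈ Finset.range n, W i ω) ∂P =
      expNeg (∑ i ∈ Finset.range n, negLog (∫⁻ ω, expNeg (W i ω) ∂P)) := by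
    intro n
    induction n with
    | zero => simp
    | succ n ih =>
      simp_rw [Finset.sum_range_succ, expNeg_add]
      rw [← ih, expNeg_negLog (lintegral_expNeg_le_one _)]
      exact lintegral_mul_eq_lintegral_mul_lintegral_of_indepFun
        (measurable_expNeg.comp (Finset.measurable_fun_sum _ fun i _ => hW i))
        (measurable_expNeg.comp (hW n))
        ((hind n).comp measurable_expNeg measurable_expNeg)
  refine tendsto_nhds_unique (tendsto_lintegral_expNeg
    (W := fun n ω => ∑ i ∈ Finset.range n, W i ω)
    (fun n => Finset.measurable_fun_sum _ fun i _ => hW i)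
    (.of_forall fun ω => ENNReal.summable.hasSum.tendsto_sum_nat)) ?_
  simp_rw [hfin]
  exact tendsto_expNeg_sum_range _

/-- Independent arguments can be integrated one after the other. -/
lemma lintegral_indepFun_prod {Ω A B : Type*} [MeasurableSpace Ω] [MeasurableSpace A]
    [MeasurableSpace B] {P : Measure Ω} [IsProbabilityMeasure P] {Y : Ω → A} {Z : Ω → B}
    (hY : Measurable Y) (hZ : Measurable Z) (hind : IndepFun Y Z P) {f : A × B → ℝ≥0∞}
    (hf : Measurable f) :
    ∫⁻ ω, f (Y ω, Z ω) ∂P = ∫⁻ ω, ∫⁻ ω', f (Y ω, Z ω') ∂P ∂P := by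
  have := Measure.isProbabilityMeasure_map (μ := P) hY.aemeasurable
  have := Measure.isProbabilityMeasure_map (μ := P) hZ.aemeasurable
  rw [← lintegral_map (g := fun ω => (Y ω, Z ω)) hf (hY.prodMk hZ),
    (indepFun_iff_map_prod_eq_prod_map_map hY.aemeasurable hZ.aemeasurable).1 hind,
    lintegral_prod _ hf.aemeasurable, lintegral_map hf.lintegral_prod_right' hY]
  refine lintegral_congr fun ω => ?_
  exact lintegral_map (hf.comp measurable_prodMk_left) hZ

/-! ### Poisson point processes: counts, Laplace functional, void probabilities -/

lemma toENNReal_pointCount (x : ℕ → Plane) (B : Set Plane) :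
    ((pointCount x B : ℕ∞) : ℝ≥0∞) = ∑' i, B.indicator 1 (x i) := by
  rw [pointCount, ← ENNReal.tsum_set_one, tsum_subtype {i | x i ∈ B} fun _ => (1 : ℝ≥0∞)]
  rfl

lemma measurable_pointCount {B : Set Plane} (hB : MeasurableSet B) :
    Measurable fun x : ℕ → Plane => pointCount x B := by
  have h : Measurable fun x : ℕ → Plane => ((pointCount x B : ℕ∞) : ℝ≥0∞) := by
    simp_rw [toENNReal_pointCount]
    exact Measurable.tsum fun i => (measurable_one.indicator hB).comp (measurable_pi_apply i)
  refine measurable_to_countable' fun n => ?_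
  convert h (measurableSet_singleton (n : ℝ≥0∞)) using 1
  ext x
  simp

section

variable {Ω : Type*} [MeasurableSpace Ω] {P : Measure Ω} [IsProbabilityMeasure P]
  {X : Ω → ℕ → Plane} {lam : ℝ}

/-- Only the finite values of the count are prescribed. Their masses sum to one, so none is left for
`⊤`. -/
lemma map_eq_map_natCast_poissonMeasure {N : Ω → ℕ∞} (hN : Measurable N) {r : ℝ≥0}
    (h : ∀ n : ℕ, P {ω | N ω = n} = poissonMeasure r {n}) :
    P.map N = (poissonMeasure r).map (fun n : ℕ => (n : ℕ∞)) := by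
  have hc : Measurable fun n : ℕ => (n : ℕ∞) := measurable_from_top
  have := Measure.isProbabilityMeasure_map (μ := P) hN.aemeasurable
  have := Measure.isProbabilityMeasure_map (μ := poissonMeasure r) hc.aemeasurable
  have hnat : ∀ n : ℕ,
      P.map N {(n : ℕ∞)} = (poissonMeasure r).map (fun n : ℕ => (n : ℕ∞)) {↑n} := by
    intro n
    rw [Measure.map_apply hN (measurableSet_singleton _),
      Measure.map_apply hc (measurableSet_singleton _)]
    refine (h n).trans (congrArg _ ?_)
    ext m; simp
  refine Measure.ext_of_singleton fun n => ?_
  induction n using ENat.recTopCoe with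
  | coe n => exact hnat n
  | top =>
    have key : ∀ μ : Measure ℕ∞, IsProbabilityMeasure μ → μ {⊤} = 1 - ∑' n : ℕ, μ {(n : ℕ∞)} := by
      intro μ _
      have hr : Set.range (fun n : ℕ => (n : ℕ∞)) = {⊤}ᶜ := by
        ext m
        induction m using ENat.recTopCoe <;> simp
      have h2 : μ {⊤}ᶜ = ∑' n : ℕ, μ {(n : ℕ∞)} := by
        rw [← hr, ← Set.iUnion_singleton_eq_range, measure_iUnion]
        · intro i j hij
          simpa using hij
        · exact fun i => measurableSet_singleton _
      rw [← h2, ← prob_compl_eq_one_sub (measurableSet_singleton _).compl, compl_compl]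
    rw [key _ inferInstance, key _ inferInstance]
    simp_rw [hnat]

/-- The probability generating function of the Poisson law, from the exponential series in r q. -/
lemma lintegral_pow_poissonMeasure (r : ℝ≥0) {q : ℝ≥0∞} (hq : q ≤ 1) :
    ∫⁻ n, q ^ n ∂(poissonMeasure r) = expNeg (r * (1 - q)) := by
  lift q to ℝ≥0 using (hq.trans_lt ENNReal.one_lt_top).ne with p
  have hp : p ≤ 1 := by exact_mod_cast hq
  have hp' : (p : ℝ) ≤ 1 := by exact_mod_cast hp
  rw [lintegral_countable']
  have h1 : (r : ℝ≥0∞) * (1 - p) = ENNReal.ofReal (r * (1 - p)) := by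
    rw [ENNReal.ofReal_mul r.coe_nonneg, ENNReal.ofReal_sub _ p.coe_nonneg]; simp
  have h0 : 0 ≤ (r : ℝ) * (1 - p) := mul_nonneg r.coe_nonneg (by linarith)
  rw [h1, expNeg_ofReal h0]
  have hs : HasSum (fun n : ℕ => (p : ℝ) ^ n * (Real.exp (-r) * r ^ n / n.factorial))
      (Real.exp (-(r * (1 - p)))) := by
    have := (NormedSpace.expSeries_div_hasSum_exp (𝔸 := ℝ) ((r : ℝ) * p)).mul_left (Real.exp (-r))
    rw [← Real.exp_eq_exp_ℝ, ← Real.exp_add] at this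
    have he : -(r : ℝ) + r * p = -(r * (1 - p)) := by ring
    have hf : (fun n : ℕ => (p : ℝ) ^ n * (Real.exp (-r) * r ^ n / n.factorial)) =
        fun n : ℕ => Real.exp (-r) * (((r : ℝ) * p) ^ n / n.factorial) := by
      ext n
      rw [mul_pow]
      ring
    rwa [he, ← hf] at this
  rw [← hs.tsum_eq, ENNReal.ofReal_tsum_of_nonneg (fun n => by positivity) hs.summable]
  refine tsum_congr fun n => ?_
  rw [poissonMeasure_singleton, ENNReal.ofReal_mul (by positivity), ENNReal.ofReal_pow p.coe_nonneg]
  simp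

lemma expNeg_mul_natCast (c : ℝ≥0∞) (n : ℕ) : expNeg (c * n) = expNeg c ^ n := by
  induction n with
  | zero => simp
  | succ n ih => rw [Nat.cast_succ, mul_add, mul_one, expNeg_add, ih, pow_succ]

namespace IsHPPP

lemma lintegral_expNeg_pointCount (hX : IsHPPP P X lam) (hlam : 0 ≤ lam) {B : Set Plane}
    (hB : MeasurableSet B) (hB' : volume B ≠ ⊤) (c : ℝ≥0∞) :
    ∫⁻ ω, expNeg (c * (pointCount (X ω) B : ℕ∞)) ∂P =
      expNeg (ENNReal.ofReal lam * (volume B * (1 - expNeg c))) := by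
  have hN : Measurable fun ω => pointCount (X ω) B := (measurable_pointCount hB).comp hX.measurable
  have hc : Measurable fun n : ℕ => (n : ℕ∞) := measurable_from_top
  rw [← lintegral_map (f := fun n : ℕ∞ => expNeg (c * n)) measurable_from_top hN,
    map_eq_map_natCast_poissonMeasure hN (hX.count_law B hB hB'),
    lintegral_map measurable_from_top hc]
  simp only [ENat.toENNReal_coe, expNeg_mul_natCast]
  rw [lintegral_pow_poissonMeasure _ (expNeg_le_one c), ← mul_assoc]
  congr 2
  change ENNReal.ofReal (lam * (volume B).toReal) = _
  rw [ENNReal.ofReal_mul hlam, ENNReal.ofReal_toReal hB']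

/-- The sum over the points is a combination of the counts of the level sets of φ, which are
independent Poisson variables because the level sets are disjoint. -/
lemma lintegral_expNeg_tsum_simpleFunc (hX : IsHPPP P X lam) (hlam : 0 ≤ lam)
    (φ : SimpleFunc Plane ℝ≥0∞) (hφ : volume {y | φ y ≠ 0} ≠ ⊤) :
    ∫⁻ ω, expNeg (∑' i, φ (X ω i)) ∂P =
      expNeg (ENNReal.ofReal lam * ∫⁻ y, (1 - expNeg (φ y))) := by
  -- The value 0 is left out: its level set may have infinite area, and it contributes nothing to
  -- either side.
  let S := φ.range.erase 0
  let e := S.equivFin.symm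
  let c : Fin S.card → ℝ≥0∞ := fun i => (e i : ℝ≥0∞)
  let B : Fin S.card → Set Plane := fun i => φ ⁻¹' {c i}
  have hc : ∀ i, c i ≠ 0 := fun i => (Finset.mem_erase.1 (e i).2).1
  have hB : ∀ i, MeasurableSet (B i) := fun i => φ.measurableSet_fiber _
  have hBv : ∀ i, volume (B i) ≠ ⊤ := fun i =>
    measure_ne_top_of_subset (fun y (hy : φ y = c i) => by simpa [hy] using hc i) hφ
  have hdisj : Pairwise fun i j => Disjoint (B i) (B j) := by
    intro i j hij
    refine Set.disjoint_left.2 fun y (hi : φ y = c i) (hj : φ y = c j) => hij ?_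
    exact e.injective (Subtype.ext (hi.symm.trans hj))
  -- Used twice: with the identity for the sum over points, and with 1 - `expNeg` for the integral.
  have hdec : ∀ F : ℝ≥0∞ → ℝ≥0∞, F 0 = 0 → ∀ y,
      F (φ y) = ∑ i, F (c i) * (B i).indicator 1 y := by
    intro F hF y
    by_cases hy : φ y = 0
    · rw [hy, hF, eq_comm]
      refine Finset.sum_eq_zero fun i _ => ?_
      have : y ∉ B i := fun h : φ y = c i => hc i (h.symm.trans hy)
      simp [this]
    · have hmem : φ y ∈ S := Finset.mem_erase.2 ⟨hy, φ.mem_range_self y⟩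
      have hi : c (e.symm ⟨φ y, hmem⟩) = φ y := by simp [c]
      rw [Finset.sum_eq_single (e.symm ⟨φ y, hmem⟩)]
      · have : y ∈ B (e.symm ⟨φ y, hmem⟩) := hi.symm
        simp [this, hi]
      · intro j _ hj
        have : y ∉ B j := by
          intro h
          have h : φ y = c j := h
          apply hj
          rw [Equiv.eq_symm_apply]
          exact Subtype.ext h.symm
        simp [this]
      · simp
  have hsum : ∀ ω, ∑' i, φ (X ω i) = ∑ j, c j * (pointCount (X ω) (B j) : ℕ∞) := by
    intro ω
    have hid : ∀ y, φ y = ∑ i, c i * (B i).indicator 1 y := hdec id rfl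
    simp_rw [hid, toENNReal_pointCount, ← ENNReal.tsum_mul_left]
    rw [Summable.tsum_finsetSum fun _ _ => ENNReal.summable]
  have hint : ∫⁻ y, (1 - expNeg (φ y)) = ∑ j, (volume (B j) * (1 - expNeg (c j))) := by
    have hsub : ∀ y, 1 - expNeg (φ y) = ∑ i, (1 - expNeg (c i)) * (B i).indicator 1 y :=
      hdec (fun t => 1 - expNeg t) (by simp)
    simp_rw [hsub]
    rw [lintegral_finsetSum _ fun j _ => (measurable_one.indicator (hB j)).const_mul _]
    refine Finset.sum_congr rfl fun j _ => ?_
    rw [lintegral_const_mul _ (measurable_one.indicator (hB j)), lintegral_indicator_one (hB j),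
      mul_comm]
  simp_rw [hsum, expNeg_sum]
  rw [hint, Finset.mul_sum, expNeg_sum,
    lintegral_prod_eq_prod_lintegral_of_indepFun Finset.univ
      (fun j ω => expNeg (c j * (pointCount (X ω) (B j) : ℕ∞)))
      ((hX.count_indep _ B hB hBv hdisj).comp (fun j n => expNeg (c j * (n : ℕ∞)))
        fun j => measurable_from_top)
      fun j => (measurable_from_top (f := fun n : ℕ∞ => expNeg (c j * n))).comp
        ((measurable_pointCount (hB j)).comp hX.measurable)]
  exact Finset.prod_congr rfl fun j _ => hX.lintegral_expNeg_pointCount hlam (hB j) (hBv j) _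

/-- The Laplace functional of a Poisson point process. -/
theorem laplace (hX : IsHPPP P X lam) (hlam : 0 ≤ lam) {φ : Plane → ℝ≥0∞} (hφ : Measurable φ) :
    ∫⁻ ω, expNeg (∑' i, φ (X ω i)) ∂P =
      expNeg (ENNReal.ofReal lam * ∫⁻ y, (1 - expNeg (φ y))) := by
  -- Restricting to growing balls gives the approximations a support of finite area while keeping
  -- them monotone.
  let ψ : ℕ → SimpleFunc Plane ℝ≥0∞ := fun n =>
    (SimpleFunc.eapprox φ n).restrict (Metric.closedBall 0 n)
  have hψ : ∀ n y, ψ n y = (Metric.closedBall (0 : Plane) n).indicator (SimpleFunc.eapprox φ n) y :=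
    fun n y => by rw [SimpleFunc.restrict_apply _ Metric.isClosed_closedBall.measurableSet]
  have hmono : ∀ y, Monotone fun n => ψ n y := by
    intro y n m hnm
    simp only [hψ]
    have hball : Metric.closedBall (0 : Plane) n ⊆ Metric.closedBall 0 m :=
      Metric.closedBall_subset_closedBall (by exact_mod_cast hnm)
    refine (Set.indicator_le_indicator_of_subset hball (fun _ => zero_le) y).trans ?_
    exact Set.indicator_le_indicator (SimpleFunc.monotone_eapprox φ hnm y)
  have hlim : ∀ y, Tendsto (fun n => ψ n y) atTop (𝓝 (φ y)) := by
    intro y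
    have h1 : Tendsto (fun n => SimpleFunc.eapprox φ n y) atTop (𝓝 (φ y)) :=
      SimpleFunc.tendsto_eapprox hφ y
    refine h1.congr' ?_
    obtain ⟨m, hm⟩ := exists_nat_ge ‖y‖
    filter_upwards [eventually_ge_atTop m] with n hn
    have : y ∈ Metric.closedBall (0 : Plane) n := by
      simpa using hm.trans (by exact_mod_cast hn)
    simp [hψ, this]
  have hfin : ∀ n, volume {y | ψ n y ≠ 0} ≠ ⊤ := by
    intro n
    have hsub : {y | ψ n y ≠ 0} ⊆ Metric.closedBall (0 : Plane) n := by
      intro y hy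
      by_contra h
      exact hy (by rw [hψ, Set.indicator_of_notMem h])
    exact measure_ne_top_of_subset hsub measure_closedBall_lt_top.ne
  have hleft : Tendsto (fun n => ∫⁻ ω, expNeg (∑' i, ψ n (X ω i)) ∂P) atTop
      (𝓝 (∫⁻ ω, expNeg (∑' i, φ (X ω i)) ∂P)) := by
    refine tendsto_lintegral_expNeg (W := fun n ω => ∑' i, ψ n (X ω i)) (fun n => ?_) ?_
    · exact Measurable.tsum fun i =>
        (ψ n).measurable.comp ((measurable_pi_apply i).comp hX.measurable)
    · refine .of_forall fun ω => ?_
      -- Sums over the points become integrals for counting measure, to which monotone convergence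
      -- applies.
      simp_rw [← lintegral_count]
      exact lintegral_tendsto_of_tendsto_of_monotone (fun n => measurable_from_top.aemeasurable)
        (.of_forall fun i => hmono _) (.of_forall fun i => hlim _)
  refine tendsto_nhds_unique hleft ?_
  simp_rw [fun n => hX.lintegral_expNeg_tsum_simpleFunc hlam (ψ n) (hfin n)]
  refine (continuous_expNeg.tendsto _).comp (ENNReal.Tendsto.const_mul ?_ (Or.inr (by simp)))
  refine lintegral_tendsto_of_tendsto_of_monotone
    (fun n => ((measurable_expNeg.comp (ψ n).measurable).const_sub 1).aemeasurable)
    (.of_forall fun y n m hnm => tsub_le_tsub_left (antitone_expNeg (hmono y hnm)) 1)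
    (.of_forall fun y => ?_)
  exact ENNReal.Tendsto.sub tendsto_const_nhds ((continuous_expNeg.tendsto _).comp (hlim y))
    (Or.inl (by simp))

/-- The void probabilities of a Poisson point process. -/
lemma prob_forall_notMem (hX : IsHPPP P X lam) (hlam : 0 ≤ lam) {B : Set Plane}
    (hB : MeasurableSet B) :
    P {ω | ∀ i, X ω i ∉ B} = expNeg (ENNReal.ofReal lam * volume B) := by
  -- With φ = ∞ on B and 0 elsewhere, `expNeg` of the sum over points is the indicator that B
  -- contains no point.
  have h := hX.laplace hlam (φ := B.indicator fun _ => ⊤) (measurable_const.indicator hB)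
  have h1 : ∫⁻ y, (1 - expNeg (B.indicator (fun _ => ⊤) y)) = volume B := by
    rw [← lintegral_indicator_one hB]
    refine lintegral_congr fun y => ?_
    by_cases hy : y ∈ B <;> simp [hy]
  have hS : MeasurableSet {ω | ∀ i, X ω i ∉ B} := by
    have : {ω | ∀ i, X ω i ∉ B} = ⋂ i, (fun ω => X ω i) ⁻¹' Bᶜ := by ext; simp
    rw [this]
    exact .iInter fun i => ((measurable_pi_apply i).comp hX.measurable) hB.compl
  rw [← h1, ← h, ← lintegral_indicator_one hS]
  refine lintegral_congr fun ω => ?_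
  by_cases hω : ∀ i, X ω i ∉ B
  · simp [Set.indicator, hω]
  · obtain ⟨i, hi⟩ := not_forall_not.1 hω
    have h2 : ∑' i, B.indicator (fun _ => (⊤ : ℝ≥0∞)) (X ω i) = ⊤ :=
      ENNReal.tsum_eq_top_of_eq_top ⟨i, by simp [hi]⟩
    rw [h2]
    simp [Set.indicator, hω]

end IsHPPP

end

/-! ### Radial integrals and Rayleigh fading -/

lemma lintegral_exp_neg_mul_Ioi {b : ℝ} (hb : 0 < b) (c : ℝ) :
    ∫⁻ u in Set.Ioi c, ENNReal.ofReal (Real.exp (-(b * u))) =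
      ENNReal.ofReal (Real.exp (-(b * c)) / b) := by
  have h := integral_exp_mul_Ioi (a := -b) (by linarith) c
  simp only [neg_mul] at h
  rw [← ofReal_integral_eq_lintegral_ofReal, h, neg_div_neg_eq]
  · have hI := integrableOn_exp_mul_Ioi (a := -b) (by linarith) c
    simp only [neg_mul] at hI
    exact hI
  · exact .of_forall fun u => (Real.exp_pos _).le

/-- Integration of a radial function over a plane, in terms of the squared norm. -/
lemma lintegral_norm_sq {E : Type*} [NormedAddCommGroup E] [MeasurableSpace E]
    [BorelSpace E] {μ : Measure E}
    (hμ : ∀ r : ℝ, μ (Metric.closedBall 0 r) = ENNReal.ofReal r ^ 2 * ENNReal.ofReal Real.pi)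
    {g : ℝ → ℝ≥0∞} (hg : Measurable g) :
    ∫⁻ y, g (‖y‖ ^ 2) ∂μ = ENNReal.ofReal Real.pi * ∫⁻ u in Set.Ioi 0, g u := by
  have hm : Measurable fun y : E => ‖y‖ ^ 2 := by fun_prop
  -- The push-forward under the squared norm is π times Lebesgue measure on the half-line, since a
  -- disc has area π times its squared radius. Nothing else about the space enters, so `ℂ` and
  -- `Plane` are both covered.
  have h1 : ∀ t,
      μ.map (fun y => ‖y‖ ^ 2) (Set.Iic t) = ENNReal.ofReal t * ENNReal.ofReal Real.pi := by
    intro t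
    rw [Measure.map_apply hm measurableSet_Iic]
    rcases le_or_gt 0 t with ht | ht
    · have : (fun y : E => ‖y‖ ^ 2) ⁻¹' Set.Iic t = Metric.closedBall 0 (√t) := by
        ext y
        simp [Real.le_sqrt (norm_nonneg y) ht]
      rw [this, hμ, ← ENNReal.ofReal_pow (Real.sqrt_nonneg t), Real.sq_sqrt ht]
    · have : (fun y : E => ‖y‖ ^ 2) ⁻¹' Set.Iic t = ∅ := by
        ext y
        simpa using ht.trans_le (sq_nonneg ‖y‖)
      simp [this, ENNReal.ofReal_of_nonpos ht.le]
  have h2 : ∀ t, (ENNReal.ofReal Real.pi • (volume.restrict (Set.Ioi (0 : ℝ)))) (Set.Iic t) =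
      ENNReal.ofReal t * ENNReal.ofReal Real.pi := by
    intro t
    rw [Measure.smul_apply, Measure.restrict_apply measurableSet_Iic, Set.inter_comm,
      Set.Ioi_inter_Iic, Real.volume_Ioc, sub_zero, smul_eq_mul, mul_comm]
  have : IsLocallyFiniteMeasure (μ.map fun y : E => ‖y‖ ^ 2) := by
    refine ⟨fun x => ⟨Set.Iic (x + 1), Iic_mem_nhds (by linarith), ?_⟩⟩
    rw [h1]
    exact ENNReal.mul_lt_top ENNReal.ofReal_lt_top ENNReal.ofReal_lt_top
  have heq : μ.map (fun y : E => ‖y‖ ^ 2) =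
      ENNReal.ofReal Real.pi • (volume.restrict (Set.Ioi (0 : ℝ))) := by
    refine Measure.ext_of_Ioc _ _ fun a b hab => ?_
    have hne : ENNReal.ofReal a * ENNReal.ofReal Real.pi ≠ ⊤ :=
      ENNReal.mul_ne_top ENNReal.ofReal_ne_top ENNReal.ofReal_ne_top
    rw [← Set.Iic_sdiff_Iic, measure_sdiff (Set.Iic_subset_Iic.2 hab.le)
      measurableSet_Iic.nullMeasurableSet (by rw [h1]; exact hne),
      measure_sdiff (Set.Iic_subset_Iic.2 hab.le)
      measurableSet_Iic.nullMeasurableSet (by rw [h2]; exact hne), h1, h1, h2, h2]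
  rw [← lintegral_map hg hm, heq, lintegral_smul_measure, smul_eq_mul]

@[fun_prop]
lemma measurable_power : Measurable power := by
  unfold power
  fun_prop

instance : IsProbabilityMeasure stdComplexGaussian :=
  Measure.isProbabilityMeasure_map Complex.measurableEquivRealProd.symm.measurable.aemeasurable

/-- With variance 1/2 the two real densities multiply to a function of the modulus alone, so the law
of the power follows by radial integration. -/
lemma stdComplexGaussian_eq_withDensity :
    stdComplexGaussian =
      volume.withDensity fun z : ℂ => ENNReal.ofReal (Real.pi⁻¹ * Real.exp (-‖z‖ ^ 2)) := by
  have hv : (1 / 2 : ℝ≥0) ≠ 0 := by simp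
  have hpdf : ∀ z : ℂ, gaussianPDF 0 (1 / 2) z.re * gaussianPDF 0 (1 / 2) z.im =
      ENNReal.ofReal (Real.pi⁻¹ * Real.exp (-‖z‖ ^ 2)) := by
    intro z
    rw [gaussianPDF, gaussianPDF, ← ENNReal.ofReal_mul (gaussianPDFReal_nonneg _ _ _)]
    congr 1
    have h2 : (2 : ℝ) * ((1 / 2 : ℝ≥0) : ℝ) = 1 := by simp
    have h1 : 2 * Real.pi * ((1 / 2 : ℝ≥0) : ℝ) = Real.pi := by
      rw [mul_right_comm, h2, one_mul]
    rw [gaussianPDFReal, gaussianPDFReal, h1, h2, mul_mul_mul_comm, ← mul_inv,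
      Real.mul_self_sqrt Real.pi_pos.le, ← Real.exp_add, ← Complex.normSq_eq_norm_sq,
      Complex.normSq_apply]
    congr 2
    ring
  refine Measure.ext_of_lintegral _ fun f hf => ?_
  have hmeas :
      Measurable fun p : ℝ × ℝ => gaussianPDF 0 (1 / 2) p.1 * gaussianPDF 0 (1 / 2) p.2 := by
    fun_prop
  have hf' : Measurable fun p : ℝ × ℝ => f (Complex.measurableEquivRealProd.symm p) :=
    hf.comp Complex.measurableEquivRealProd.symm.measurable
  rw [stdComplexGaussian, lintegral_map hf Complex.measurableEquivRealProd.symm.measurable,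
    gaussianReal_of_var_ne_zero _ hv, prod_withDensity (by fun_prop) (by fun_prop),
    lintegral_withDensity_eq_lintegral_mul _ hmeas hf', ← Measure.volume_eq_prod,
    ← Complex.volume_preserving_equiv_real_prod.lintegral_comp (hmeas.mul hf'),
    lintegral_withDensity_eq_lintegral_mul _ (by fun_prop) hf]
  refine lintegral_congr fun z => ?_
  simp only [Pi.mul_apply, MeasurableEquiv.symm_apply_apply]
  rw [← hpdf]
  rfl

/-- The squared modulus of a standard complex Gaussian variable is exponential with mean one. -/
lemma lintegral_power {F : ℝ≥0∞ → ℝ≥0∞} (hF : Measurable F) :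
    ∫⁻ z, F (power z) ∂stdComplexGaussian =
      ∫⁻ u in Set.Ioi 0, ENNReal.ofReal (Real.exp (-u)) * F (ENNReal.ofReal u) := by
  have hpi := Real.pi_pos
  rw [stdComplexGaussian_eq_withDensity, lintegral_withDensity_eq_lintegral_mul _ (by fun_prop)
    (by fun_prop)]
  have h := lintegral_norm_sq (μ := (volume : Measure ℂ))
    (fun r => by
      rw [Complex.volume_closedBall]
      congr 1
      rw [← NNReal.coe_real_pi, ENNReal.ofReal_coe_nnreal])
    (g := fun u => ENNReal.ofReal (Real.pi⁻¹ * Real.exp (-u)) * F (ENNReal.ofReal u)) (by fun_prop)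
  refine h.trans ?_
  rw [← lintegral_const_mul _ (by fun_prop)]
  refine lintegral_congr fun u => ?_
  rw [← mul_assoc, ← ENNReal.ofReal_mul hpi.le, mul_inv_cancel_left₀ hpi.ne']

/-- The threshold may be `⊤`, because it will be a multiple of an interference not yet known to be
finite. -/
lemma prob_lt_power (t : ℝ≥0∞) : stdComplexGaussian {z | t < power z} = expNeg t := by
  have hF : Measurable ((Set.Ioi t).indicator (1 : ℝ≥0∞ → ℝ≥0∞)) :=
    measurable_one.indicator measurableSet_Ioi
  have h := lintegral_power hF
  have hl : ∫⁻ z, (Set.Ioi t).indicator (1 : ℝ≥0∞ → ℝ≥0∞) (power z) ∂stdComplexGaussian =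
      stdComplexGaussian {z | t < power z} := by
    rw [← lintegral_indicator_one (measurableSet_lt measurable_const measurable_power)]
    rfl
  rw [← hl, h]
  induction t using ENNReal.recTopCoe with
  | top => simp
  | coe t =>
    have h1 : ∀ u, ENNReal.ofReal (Real.exp (-u)) *
        (Set.Ioi (t : ℝ≥0∞)).indicator (1 : ℝ≥0∞ → ℝ≥0∞) (ENNReal.ofReal u) =
        (Set.Ioi (t : ℝ)).indicator (fun u => ENNReal.ofReal (Real.exp (-u))) u := by
      intro u
      have : (t : ℝ≥0∞) < ENNReal.ofReal u ↔ (t : ℝ) < u := by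
        rw [← ENNReal.ofReal_coe_nnreal, ENNReal.ofReal_lt_ofReal_iff_of_nonneg t.coe_nonneg]
      by_cases hu : (t : ℝ) < u
      · simp [hu, this.2 hu]
      · simp [hu, this]
    simp_rw [h1]
    rw [lintegral_indicator measurableSet_Ioi, Measure.restrict_restrict measurableSet_Ioi,
      Set.inter_eq_left.2 (Set.Ioi_subset_Ioi t.coe_nonneg)]
    have := lintegral_exp_neg_mul_Ioi one_pos t
    simp only [one_mul, div_one] at this
    rw [this, ← expNeg_ofReal t.coe_nonneg, ENNReal.ofReal_coe_nnreal]

/-- The case s = `⊤` occurs when an interferer sits exactly at the receiver and its path loss is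
infinite. -/
lemma lintegral_expNeg_mul_power (s : ℝ≥0∞) :
    ∫⁻ z, expNeg (s * power z) ∂stdComplexGaussian = (1 + s)⁻¹ := by
  rw [lintegral_power (F := fun v => expNeg (s * v)) (by fun_prop)]
  induction s using ENNReal.recTopCoe with
  | top =>
    rw [setLIntegral_congr_fun (g := fun _ => 0) measurableSet_Ioi]
    · simp
    · intro u (hu : 0 < u)
      simp [ENNReal.top_mul, hu]
  | coe s =>
    have hs : (0 : ℝ) < 1 + s := by positivity
    rw [setLIntegral_congr_fun (g := fun u => ENNReal.ofReal (Real.exp (-((1 + s : ℝ) * u))))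
      measurableSet_Ioi]
    · rw [lintegral_exp_neg_mul_Ioi hs, mul_zero, neg_zero, Real.exp_zero, one_div,
        ENNReal.ofReal_inv_of_pos hs, ENNReal.ofReal_add zero_le_one s.coe_nonneg]
      simp
    · intro u (hu : 0 < u)
      simp only
      rw [← ENNReal.ofReal_coe_nnreal, ← ENNReal.ofReal_mul s.coe_nonneg,
        expNeg_ofReal (by positivity), ← ENNReal.ofReal_mul (Real.exp_pos _).le, ← Real.exp_add]
      congr 2
      ring

/-- Write 1/(1 + v) as the integral of exp(-(1 + v)t) over t > 0 and exchange the integrals. The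
u-integral gives Γ(1 + 1/p)(s/t)^(1/p); the remaining t-integral is Γ(1 - 1/p), convergent because p
> 1. -/
lemma lintegral_one_add_rpow_div_inv {p s : ℝ} (hp : 1 < p) (hs : 0 < s) :
    ∫⁻ u in Set.Ioi 0, ENNReal.ofReal ((1 + u ^ p / s)⁻¹) =
      ENNReal.ofReal (s ^ (1 / p) * (Real.Gamma (1 + 1 / p) * Real.Gamma (1 - 1 / p))) := by
  have hp0 : 0 < p := by linarith
  have hip : 1 / p < 1 := by rw [div_lt_one hp0]; exact hp
  have hinner : ∀ u ∈ Set.Ioi (0 : ℝ), ENNReal.ofReal ((1 + u ^ p / s)⁻¹) =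
      ∫⁻ t in Set.Ioi 0, ENNReal.ofReal (Real.exp (-((1 + u ^ p / s) * t))) := by
    intro u hu
    have hu : 0 < u := hu
    rw [lintegral_exp_neg_mul_Ioi (by positivity), mul_zero, neg_zero, Real.exp_zero, one_div]
  rw [setLIntegral_congr_fun measurableSet_Ioi hinner, lintegral_lintegral_swap
    (by unfold Function.uncurry; fun_prop)]
  have houter : ∀ t ∈ Set.Ioi (0 : ℝ),
      ∫⁻ u in Set.Ioi 0, ENNReal.ofReal (Real.exp (-((1 + u ^ p / s) * t))) =
      ENNReal.ofReal (s ^ (1 / p) * Real.Gamma (1 + 1 / p) *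
        (Real.exp (-t) * t ^ ((1 - 1 / p) - 1))) := by
    intro t ht
    have ht : 0 < t := ht
    have hts : 0 < t / s := by positivity
    have h1 := integral_exp_neg_mul_rpow hp0 hts
    have hI : IntegrableOn (fun u => Real.exp (-(t / s) * u ^ p)) (Set.Ioi 0) := by
      simpa using integrableOn_rpow_mul_exp_neg_mul_rpow (s := 0) (by norm_num) hp0 hts
    have h2 : ∀ u, ENNReal.ofReal (Real.exp (-((1 + u ^ p / s) * t))) =
        ENNReal.ofReal (Real.exp (-t)) * ENNReal.ofReal (Real.exp (-(t / s) * u ^ p)) := by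
      intro u
      rw [← ENNReal.ofReal_mul (Real.exp_pos _).le, ← Real.exp_add]
      congr 2
      ring
    simp_rw [h2]
    rw [lintegral_const_mul _ (by fun_prop), ← ofReal_integral_eq_lintegral_ofReal hI
      (.of_forall fun u => (Real.exp_pos _).le), h1, ← ENNReal.ofReal_mul (Real.exp_pos _).le]
    congr 1
    rw [Real.div_rpow ht.le hs.le, neg_div, Real.rpow_neg hs.le, div_inv_eq_mul,
      sub_sub_cancel_left, add_comm (1 / p)]
    ring
  rw [setLIntegral_congr_fun measurableSet_Ioi houter]
  have hG : (0 : ℝ) < Real.Gamma (1 + 1 / p) := Real.Gamma_pos_of_pos (by positivity)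
  rw [← ofReal_integral_eq_lintegral_ofReal
    ((Real.GammaIntegral_convergent (s := 1 - 1 / p) (by linarith)).const_mul _),
    integral_const_mul,
    ← Real.Gamma_eq_integral (by linarith), mul_assoc]
  refine (ae_restrict_mem measurableSet_Ioi).mono fun t ht => ?_
  have ht : (0 : ℝ) < t := ht
  positivity

/-! ### Shot noise and the signal-to-interference ratio of one link -/

@[fun_prop]
lemma measurable_pathLoss {A : Type*} [MeasurableSpace A] (alpha : ℝ) {f g : A → Plane}
    (hf : Measurable f) (hg : Measurable g) : Measurable fun a => pathLoss alpha (f a) (g a) := by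
  unfold pathLoss
  fun_prop

/-- The exponent in the Laplace transform of the interference of a Poisson process of unit
intensity. -/
lemma lintegral_one_sub_inv_pathLoss {alpha : ℝ} (halpha : 2 < alpha) {s : ℝ≥0∞} (hs : s ≠ ⊤)
    (z : Plane) :
    ∫⁻ y, (1 - (1 + s * pathLoss alpha y z)⁻¹) =
      ENNReal.ofReal (Real.pi * Real.Gamma (1 + 2 / alpha) * Real.Gamma (1 - 2 / alpha)) *
        s ^ (2 / alpha) := by
  have ha : 0 < alpha := by linarith
  lift s to ℝ≥0 using hs
  set p := alpha / 2 with hpdef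
  have hp : 1 < p := by rw [hpdef]; linarith
  have hip : 1 / p = 2 / alpha := by rw [hpdef, one_div_div]
  -- In terms of the squared distance u the path loss is u^(-p) with p = α/2. For s > 0 the
  -- integrand is 1/(1 + u^p/s); s = 0 is separated because of this division.
  let g : ℝ → ℝ≥0∞ := fun u => 1 - (1 + s * ENNReal.ofReal u ^ (-p))⁻¹
  have hg : Measurable g := by unfold g; fun_prop
  have hshift : ∀ y, 1 - (1 + s * pathLoss alpha y z)⁻¹ = g (‖y - z‖ ^ 2) := by
    intro y
    simp only [g, pathLoss, dist_eq_norm]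
    rw [ENNReal.ofReal_pow (norm_nonneg _), ← ENNReal.rpow_natCast, ← ENNReal.rpow_mul]
    congr 5
    rw [hpdef]
    push_cast
    ring
  simp_rw [hshift]
  rw [lintegral_sub_right_eq_self fun y : Plane => g (‖y‖ ^ 2), lintegral_norm_sq
    (fun r => EuclideanSpace.volume_closedBall_fin_two 0 r) hg]
  rcases eq_or_ne s 0 with rfl | hs0
  · simp [g, ha]
  have hs : (0 : ℝ) < s := by exact_mod_cast pos_iff_ne_zero.2 hs0
  rw [setLIntegral_congr_fun (g := fun u => ENNReal.ofReal ((1 + u ^ p / s)⁻¹)) measurableSet_Ioi,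
    lintegral_one_add_rpow_div_inv hp hs, hip, ← ENNReal.ofReal_mul Real.pi_pos.le]
  · rw [← ENNReal.ofReal_coe_nnreal, ENNReal.ofReal_rpow_of_pos hs,
      ← ENNReal.ofReal_mul' (by positivity)]
    congr 1
    ring
  · intro u hu
    have hu : 0 < u := hu
    have hup : 0 < u ^ p := Real.rpow_pos_of_pos hu _
    simp only [g]
    rw [ENNReal.ofReal_rpow_of_pos hu, ← ENNReal.ofReal_coe_nnreal, ← ENNReal.ofReal_mul hs.le,
      ← ENNReal.ofReal_one, ← ENNReal.ofReal_add zero_le_one (by positivity),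
      ← ENNReal.ofReal_inv_of_pos (by positivity), ← ENNReal.ofReal_sub _ (by positivity)]
    congr 1
    rw [Real.rpow_neg hu.le]
    field_simp
    ring

/-- The interference received at `z` from transmitters at the points `n.1` with fading
coefficients `n.2`. -/
noncomputable def shotNoise (alpha : ℝ) (z : Plane) (n : (ℕ → Plane) × (ℕ → ℂ)) : ℝ≥0∞ :=
  ∑' i, power (n.2 i) * pathLoss alpha (n.1 i) z

/-- What a receiver sees: the fading coefficient of the signal, then locations and fading
coefficients of the interfering sensors and of the interfering access points. -/
abbrev Link : Type := ℂ × ((ℕ → Plane) × (ℕ → ℂ)) × ((ℕ → Plane) × (ℕ → ℂ))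

/-- The signal-to-interference ratio at a receiver located at `z`. -/
noncomputable def linkSIR (alpha mu : ℝ) (z : Plane) (n : Link) : ℝ≥0∞ :=
  power n.1 * pathLoss alpha 0 z /
    (shotNoise alpha z n.2.1 + ENNReal.ofReal mu * shotNoise alpha z n.2.2)

@[fun_prop]
lemma measurable_shotNoise {A : Type*} [MeasurableSpace A] (alpha : ℝ) {f : A → Plane}
    {g : A → (ℕ → Plane) × (ℕ → ℂ)} (hf : Measurable f) (hg : Measurable g) :
    Measurable fun a => shotNoise alpha (f a) (g a) := by
  unfold shotNoise
  exact Measurable.tsum fun i => by fun_prop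

@[fun_prop]
lemma measurable_linkSIR {A : Type*} [MeasurableSpace A] (alpha mu : ℝ) {f : A → Plane}
    {g : A → Link} (hf : Measurable f) (hg : Measurable g) :
    Measurable fun a => linkSIR alpha mu (f a) (g a) := by
  unfold linkSIR
  fun_prop

section

variable {Ω : Type*} [MeasurableSpace Ω] (P : Measure Ω)

/-- A homogeneous Poisson process of interferers with independent Rayleigh fading. -/
structure IsMarkedHPPP (N : Ω → (ℕ → Plane) × (ℕ → ℂ)) (lam : ℝ) : Prop where
  hppp : IsHPPP P (fun ω => (N ω).1) lam
  measurable_marks : ∀ i, Measurable fun ω => (N ω).2 i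
  law_marks : ∀ i, P.map (fun ω => (N ω).2 i) = stdComplexGaussian
  indep_marks : iIndepFun (fun i ω => (N ω).2 i) P
  indep : IndepFun (fun ω => (N ω).1) (fun ω => (N ω).2) P

/-- The joint law of the fading of the signal and of the two independent families of
interferers. -/
structure IsLink (N : Ω → Link) (lamS lamA : ℝ) : Prop where
  measurable_signal : Measurable fun ω => (N ω).1
  law_signal : P.map (fun ω => (N ω).1) = stdComplexGaussian
  sensors : IsMarkedHPPP P (fun ω => (N ω).2.1) lamS
  accessPoints : IsMarkedHPPP P (fun ω => (N ω).2.2) lamA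
  indep_signal : IndepFun (fun ω => (N ω).1) (fun ω => (N ω).2) P
  indep_interference : IndepFun (fun ω => (N ω).2.1) (fun ω => (N ω).2.2) P

variable {P} [IsProbabilityMeasure P]

omit [IsProbabilityMeasure P] in
lemma IsMarkedHPPP.measurable {N : Ω → (ℕ → Plane) × (ℕ → ℂ)} {lam : ℝ}
    (hN : IsMarkedHPPP P N lam) : Measurable N :=
  hN.hppp.measurable.prodMk (measurable_pi_lambda _ hN.measurable_marks)

/-- The Laplace transform of the interference. -/
lemma IsMarkedHPPP.laplace_shotNoise {N : Ω → (ℕ → Plane) × (ℕ → ℂ)} {lam : ℝ}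
    (hN : IsMarkedHPPP P N lam) (hlam : 0 ≤ lam) {alpha : ℝ} (halpha : 2 < alpha) (z : Plane)
    {s : ℝ≥0∞} (hs : s ≠ ⊤) :
    ∫⁻ ω, expNeg (s * shotNoise alpha z (N ω)) ∂P =
      expNeg (ENNReal.ofReal lam *
        (ENNReal.ofReal (Real.pi * Real.Gamma (1 + 2 / alpha) * Real.Gamma (1 - 2 / alpha)) *
          s ^ (2 / alpha))) := by
  have hmarks : Measurable fun ω => (N ω).2 := measurable_pi_lambda _ hN.measurable_marks
  have hinv : ∀ y, (1 + s * pathLoss alpha y z)⁻¹ ≤ 1 := fun y =>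
    ENNReal.inv_le_one.2 le_self_add
  rw [lintegral_indepFun_prod (f := fun n => expNeg (s * shotNoise alpha z n))
    hN.hppp.measurable hmarks hN.indep (by fun_prop)]
  -- For fixed positions the transform is the product of the factors 1/(1 + s · path loss). Written
  -- through `negLog`, it is again an exponential of a sum over the points, so the Laplace
  -- functional can average over the positions.
  have hinner : ∀ x : ℕ → Plane, ∫⁻ ω', expNeg (s * shotNoise alpha z (x, (N ω').2)) ∂P =
      expNeg (∑' i, negLog ((1 + s * pathLoss alpha (x i) z)⁻¹)) := by
    intro x
    have hi := hN.indep_marks.comp (fun i g => s * pathLoss alpha (x i) z * power g)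
      (fun i => by fun_prop)
    have h1 : ∀ i, ∫⁻ ω', expNeg (s * pathLoss alpha (x i) z * power ((N ω').2 i)) ∂P =
        (1 + s * pathLoss alpha (x i) z)⁻¹ := by
      intro i
      rw [← lintegral_expNeg_mul_power, ← hN.law_marks i,
        lintegral_map (by fun_prop) (hN.measurable_marks i)]
    have hm : ∀ i, Measurable fun ω' => s * pathLoss alpha (x i) z * power ((N ω').2 i) :=
      fun i => (measurable_power.comp (hN.measurable_marks i)).const_mul _
    have h2 := lintegral_expNeg_tsum (P := P)
      (W := fun i ω' => s * pathLoss alpha (x i) z * power ((N ω').2 i)) hm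
      (fun n => by
        have := hi.indepFun_finsetSum_of_notMem hm (s := Finset.range n) (i := n) (by simp)
        convert this using 1
        · ext ω
          simp
        · rfl)
    simp_rw [h1] at h2
    rw [← h2]
    refine lintegral_congr fun ω' => ?_
    rw [shotNoise, ← ENNReal.tsum_mul_left]
    congr 2
    ext i
    ring
  simp_rw [hinner]
  rw [hN.hppp.laplace hlam (φ := fun y => negLog ((1 + s * pathLoss alpha y z)⁻¹)) (by fun_prop),
    ← lintegral_one_sub_inv_pathLoss halpha hs z]
  simp_rw [expNeg_negLog (hinv _)]

omit [IsProbabilityMeasure P] in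
lemma IsLink.measurable {N : Ω → Link} {lamS lamA : ℝ} (hN : IsLink P N lamS lamA) :
    Measurable N :=
  hN.measurable_signal.prodMk (hN.sensors.measurable.prodMk hN.accessPoints.measurable)

/-- The tail of the signal-to-interference ratio at a receiver with given location. -/
lemma IsLink.prob_lt_linkSIR {N : Ω → Link} {lamS rhoS lamAP rhoAP : ℝ}
    (hN : IsLink P N (lamS * rhoS) (lamAP * rhoAP)) (hS : 0 ≤ lamS * rhoS) (hA : 0 ≤ lamAP * rhoAP)
    {alpha mu : ℝ} (halpha : 2 < alpha) (hmu : 0 < mu) {z : Plane} (hz : z ≠ 0) {x : ℝ}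
    (hx : 0 < x) :
    P {ω | ENNReal.ofReal x < linkSIR alpha mu z (N ω)} =
      expNeg (ENNReal.ofReal
        (Lambda1 lamS rhoS lamAP rhoAP mu alpha * x ^ (2 / alpha) * ‖z‖ ^ 2)) := by
  have ha : 0 < alpha := by linarith
  have hz' : 0 < ‖z‖ := norm_pos_iff.2 hz
  have hp0 : pathLoss alpha 0 z = ENNReal.ofReal (‖z‖ ^ (-alpha)) := by
    rw [pathLoss, dist_zero_left, ENNReal.ofReal_rpow_of_pos hz']
  have hpne : pathLoss alpha 0 z ≠ 0 := by
    rw [hp0]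
    exact (ENNReal.ofReal_pos.2 (by positivity)).ne'
  have hpnt : pathLoss alpha 0 z ≠ ⊤ := by
    rw [hp0]
    exact ENNReal.ofReal_ne_top
  -- Clearing the denominator and the path loss of the signal, the ratio exceeds x exactly when the
  -- power of the signal coefficient exceeds s times the interference.
  set s : ℝ := x * ‖z‖ ^ alpha with hs
  have hs0 : 0 < s := by positivity
  let J : ((ℕ → Plane) × (ℕ → ℂ)) × ((ℕ → Plane) × (ℕ → ℂ)) → ℝ≥0∞ := fun n =>
    ENNReal.ofReal s * shotNoise alpha z n.1 + ENNReal.ofReal (s * mu) * shotNoise alpha z n.2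
  have hJ : Measurable J := by unfold J; fun_prop
  have hset : {ω | ENNReal.ofReal x < linkSIR alpha mu z (N ω)} =
      {ω | J (N ω).2 < power (N ω).1} := by
    ext ω
    -- Since x is neither 0 nor ∞, the denominator may be cleared even where the interference is 0
    -- or ∞.
    have hxne : ENNReal.ofReal x ≠ 0 := (ENNReal.ofReal_pos.2 hx).ne'
    rw [Set.mem_ofPred_eq, Set.mem_ofPred_eq, linkSIR,
      ENNReal.lt_div_iff_mul_lt (Or.inr ENNReal.ofReal_ne_top) (Or.inr hxne),
      ← ENNReal.div_lt_iff (Or.inl hpne) (Or.inl hpnt)]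
    have : ENNReal.ofReal x * (shotNoise alpha z (N ω).2.1 +
        ENNReal.ofReal mu * shotNoise alpha z (N ω).2.2) / pathLoss alpha 0 z = J (N ω).2 := by
      simp only [J]
      rw [hp0, div_eq_mul_inv, ← ENNReal.ofReal_inv_of_pos (by positivity),
        Real.rpow_neg hz'.le, inv_inv, mul_right_comm, ← ENNReal.ofReal_mul hx.le, ← hs, mul_add,
        ENNReal.ofReal_mul hs0.le, mul_assoc (ENNReal.ofReal s)]
    rw [this]
  have hm := hN.measurable
  let F : (((ℕ → Plane) × (ℕ → ℂ)) × ((ℕ → Plane) × (ℕ → ℂ))) × ℂ → ℝ≥0∞ :=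
    {p | J p.1 < power p.2}.indicator 1
  have hF : Measurable F :=
    measurable_one.indicator (measurableSet_lt (by fun_prop) (by fun_prop))
  have hcond := lintegral_indepFun_prod (P := P) (f := F) (by fun_prop) (by fun_prop)
    hN.indep_signal.symm hF
  have hleft : ∫⁻ ω, F ((N ω).2, (N ω).1) ∂P = P {ω | J (N ω).2 < power (N ω).1} := by
    rw [← lintegral_indicator_one (measurableSet_lt (by fun_prop) (by fun_prop))]
    rfl
  have hinner : ∀ n, ∫⁻ ω, F (n, (N ω).1) ∂P = expNeg (J n) := by
    intro n
    rw [← prob_lt_power, ← hN.law_signal, Measure.map_apply (by fun_prop)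
      (measurableSet_lt measurable_const measurable_power),
      ← lintegral_indicator_one (measurableSet_lt (by fun_prop) (by fun_prop) |>.preimage
        hN.measurable_signal)]
    rfl
  have hmul : ∫⁻ ω, expNeg (ENNReal.ofReal s * shotNoise alpha z (N ω).2.1) *
        expNeg (ENNReal.ofReal (s * mu) * shotNoise alpha z (N ω).2.2) ∂P =
      (∫⁻ ω, expNeg (ENNReal.ofReal s * shotNoise alpha z (N ω).2.1) ∂P) *
        ∫⁻ ω, expNeg (ENNReal.ofReal (s * mu) * shotNoise alpha z (N ω).2.2) ∂P :=
    lintegral_mul_eq_lintegral_mul_lintegral_of_indepFun (by fun_prop) (by fun_prop)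
      (hN.indep_interference.comp
        (φ := fun n => expNeg (ENNReal.ofReal s * shotNoise alpha z n))
        (ψ := fun n => expNeg (ENNReal.ofReal (s * mu) * shotNoise alpha z n))
        (by fun_prop) (by fun_prop))
  rw [hset, ← hleft, hcond]
  simp_rw [hinner, J, expNeg_add]
  rw [hmul,
    hN.sensors.laplace_shotNoise hS halpha z ENNReal.ofReal_ne_top,
    hN.accessPoints.laplace_shotNoise hA halpha z ENNReal.ofReal_ne_top, ← expNeg_add,
    ENNReal.ofReal_rpow_of_pos hs0, ENNReal.ofReal_rpow_of_pos (by positivity)]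
  have hG1 : 0 < Real.Gamma (1 + 2 / alpha) := Real.Gamma_pos_of_pos (by positivity)
  have hG2 : 0 < Real.Gamma (1 - 2 / alpha) :=
    Real.Gamma_pos_of_pos (by rw [sub_pos, div_lt_one ha]; exact halpha)
  have hpi := Real.pi_pos
  -- The exponent 2/α turns ‖z‖^α into ‖z‖², whatever α is; this makes the later averages over
  -- positions explicit.
  have hsr : s ^ (2 / alpha) = x ^ (2 / alpha) * ‖z‖ ^ 2 := by
    rw [hs, Real.mul_rpow hx.le (by positivity), ← Real.rpow_mul hz'.le, mul_div_cancel₀ _ ha.ne']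
    norm_num
  rw [← ENNReal.ofReal_mul (by positivity), ← ENNReal.ofReal_mul hS,
    ← ENNReal.ofReal_mul (by positivity), ← ENNReal.ofReal_mul hA,
    ← ENNReal.ofReal_add (by positivity) (by positivity), Real.mul_rpow hs0.le hmu.le, hsr, Lambda1]
  congr 2
  ring

end

/-! ### Independence of disjoint groups of random elements -/

/-- A finite intersection splits into a left and a right part, each measurable for the supremum on
its side. This merges point processes and fading coefficients into one independent family. -/
lemma iIndep_sumElim {Ω ι κ : Type*} [MeasurableSpace Ω] {P : Measure Ω}
    {mA : ι → MeasurableSpace Ω} {mB : κ → MeasurableSpace Ω} (hA : iIndep mA P) (hB : iIndep mB P)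
    (hAB : Indep (⨆ i, mA i) (⨆ i, mB i) P) : iIndep (Sum.elim mA mB) P := by
  rw [iIndep_iff] at hA hB ⊢
  intro s f hf
  have hfA : ∀ i ∈ s.toLeft, MeasurableSet[mA i] (f (Sum.inl i)) := fun i hi =>
    hf _ (Finset.mem_toLeft.1 hi)
  have hfB : ∀ i ∈ s.toRight, MeasurableSet[mB i] (f (Sum.inr i)) := fun i hi =>
    hf _ (Finset.mem_toRight.1 hi)
  have hset : ⋂ i ∈ s, f i = (⋂ i ∈ s.toLeft, f (Sum.inl i)) ∩ ⋂ i ∈ s.toRight, f (Sum.inr i) := by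
    ext ω
    simp
  have hmA : MeasurableSet[⨆ i, mA i] (⋂ i ∈ s.toLeft, f (Sum.inl i)) :=
    @Finset.measurableSet_biInter _ _ (⨆ i, mA i) _ s.toLeft fun i hi => le_iSup mA i _ (hfA i hi)
  have hmB : MeasurableSet[⨆ i, mB i] (⋂ i ∈ s.toRight, f (Sum.inr i)) :=
    @Finset.measurableSet_biInter _ _ (⨆ i, mB i) _ s.toRight fun i hi => le_iSup mB i _ (hfB i hi)
  rw [hset, (Indep_iff _ _ _).1 hAB _ _ hmA hmB, hA _ hfA, hB _ hfB]
  conv_rhs => rw [← Finset.toLeft_disjSum_toRight (u := s)]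
  rw [Finset.prod_disjSum]

/-- The independent groups of random elements of the network. -/
inductive Source : Type
  | idleAPs : Source
  | eavesdroppers : Source
  | signal (r : Receiver) : Source
  | sensors (r : Receiver) : Source
  | sensorFading (r : Receiver) : Source
  | accessPoints (r : Receiver) : Source
  | accessPointFading (r : Receiver) : Source
  | sinks : Source

/-- The group to which a point process or a fading coefficient belongs. -/
def source : Proc ⊕ Channel 1 → Source
  | Sum.inl Proc.idleAP => Source.idleAPs
  | Sum.inl Proc.eavesdropper => Source.eavesdroppers
  | Sum.inl (Proc.activeSensor r) => Source.sensors r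
  | Sum.inl (Proc.activeAP r) => Source.accessPoints r
  | Sum.inr (Channel.sensorAP _) => Source.signal Receiver.ap
  | Sum.inr (Channel.interfSensorAP _ _) => Source.sensorFading Receiver.ap
  | Sum.inr (Channel.interfAPAP _ _ _) => Source.accessPointFading Receiver.ap
  | Sum.inr (Channel.sensorEve k) => Source.signal (Receiver.eve k)
  | Sum.inr (Channel.interfSensorEve k _) => Source.sensorFading (Receiver.eve k)
  | Sum.inr (Channel.interfAPEve k _ _) => Source.accessPointFading (Receiver.eve k)
  | Sum.inr (Channel.apSink _ _ _) => Source.sinks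

/-- The receiver at which the elements of a group matter, apart from its location. -/
def Source.receiver : Source → Option Receiver
  | idleAPs => none
  | eavesdroppers => none
  | signal r => some r
  | sensors r => some r
  | sensorFading r => some r
  | accessPoints r => some r
  | accessPointFading r => some r
  | sinks => none

/-- The channel from the typical sensor to a receiver. -/
def signalChannel : Receiver → Channel 1
  | Receiver.ap => Channel.sensorAP 0
  | Receiver.eve k => Channel.sensorEve k

/-- The channel from an interfering sensor to a receiver. -/
def sensorChannel : Receiver → ℕ → Channel 1
  | Receiver.ap, i => Channel.interfSensorAP i 0
  | Receiver.eve k, i => Channel.interfSensorEve k i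

/-- The channel from an interfering access point to a receiver. -/
def accessPointChannel : Receiver → ℕ → Channel 1
  | Receiver.ap, j => Channel.interfAPAP j 0 0
  | Receiver.eve k, j => Channel.interfAPEve k j 0

lemma source_signalChannel (r : Receiver) :
    source (Sum.inr (signalChannel r)) = Source.signal r := by
  cases r <;> rfl

lemma source_sensorChannel (r : Receiver) (i : ℕ) :
    source (Sum.inr (sensorChannel r i)) = Source.sensorFading r := by
  cases r <;> rfl

lemma source_accessPointChannel (r : Receiver) (j : ℕ) :
    source (Sum.inr (accessPointChannel r j)) = Source.accessPointFading r := by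
  cases r <;> rfl

lemma sensorChannel_injective (r : Receiver) : Function.Injective (sensorChannel r) := by
  intro i j hij
  cases r <;> simpa [sensorChannel] using hij

lemma accessPointChannel_injective (r : Receiver) :
    Function.Injective (accessPointChannel r) := by
  intro i j hij
  cases r <;> simpa [accessPointChannel] using hij

/-- What the receiver `r` sees. -/
def netLink {Ω : Type*} (X : Proc → Ω → ℕ → Plane) (h : Channel 1 → Ω → ℂ) (r : Receiver) (ω : Ω) :
    Link :=
  (h (signalChannel r) ω,
    (X (Proc.activeSensor r) ω, fun i => h (sensorChannel r i) ω),
    (X (Proc.activeAP r) ω, fun j => h (accessPointChannel r j) ω))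

section

variable {Ω : Type*} [mΩ : MeasurableSpace Ω] {P : Measure Ω} {lamS rhoS lamAP rhoAP lamE : ℝ}
  {X : Proc → Ω → ℕ → Plane} {h : Channel 1 → Ω → ℂ}

/-- The σ-algebra generated by a point process or a fading coefficient. -/
noncomputable abbrev elementSigma (X : Proc → Ω → ℕ → Plane) (h : Channel 1 → Ω → ℂ) :
    Proc ⊕ Channel 1 → MeasurableSpace Ω :=
  Sum.elim (fun p => MeasurableSpace.comap (X p) inferInstance)
    (fun c => MeasurableSpace.comap (h c) inferInstance)

/-- The σ-algebra generated by some groups of random elements. -/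
noncomputable abbrev netSigma (X : Proc → Ω → ℕ → Plane) (h : Channel 1 → Ω → ℂ) (S : Set Source) :
    MeasurableSpace Ω :=
  ⨆ i ∈ source ⁻¹' S, elementSigma X h i

omit mΩ in
lemma measurable_netSigma_location {S : Set Source} {p : Proc} (hp : source (Sum.inl p) ∈ S) :
    Measurable[netSigma X h S] (X p) :=
  Measurable.of_comap_le (le_iSup₂_of_le (f := fun i (_ : i ∈ source ⁻¹' S) => elementSigma X h i)
    (Sum.inl p) hp le_rfl)

omit mΩ in
lemma measurable_netSigma_fading {S : Set Source} {c : Channel 1} (hc : source (Sum.inr c) ∈ S) :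
    Measurable[netSigma X h S] (h c) :=
  Measurable.of_comap_le (le_iSup₂_of_le (f := fun i (_ : i ∈ source ⁻¹' S) => elementSigma X h i)
    (Sum.inr c) hc le_rfl)

omit mΩ in
lemma measurable_netSigma_sensors {S : Set Source} {r : Receiver} (h1 : Source.sensors r ∈ S)
    (h2 : Source.sensorFading r ∈ S) :
    Measurable[netSigma X h S] fun ω => (netLink X h r ω).2.1 :=
  @Measurable.prodMk _ (netSigma X h S) _ _ _ _ (X (Proc.activeSensor r))
    (fun ω i => h (sensorChannel r i) ω) (measurable_netSigma_location h1)
    (@measurable_pi_lambda _ _ _ (netSigma X h S) _ _ fun i =>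
      measurable_netSigma_fading (by rwa [source_sensorChannel]))

omit mΩ in
lemma measurable_netSigma_accessPoints {S : Set Source} {r : Receiver}
    (h1 : Source.accessPoints r ∈ S) (h2 : Source.accessPointFading r ∈ S) :
    Measurable[netSigma X h S] fun ω => (netLink X h r ω).2.2 :=
  @Measurable.prodMk _ (netSigma X h S) _ _ _ _ (X (Proc.activeAP r))
    (fun ω i => h (accessPointChannel r i) ω) (measurable_netSigma_location h1)
    (@measurable_pi_lambda _ _ _ (netSigma X h S) _ _ fun i =>
      measurable_netSigma_fading (by rwa [source_accessPointChannel]))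

omit mΩ in
lemma measurable_netSigma_interference {S : Set Source} {r : Receiver}
    (h1 : Source.sensors r ∈ S) (h2 : Source.sensorFading r ∈ S)
    (h3 : Source.accessPoints r ∈ S) (h4 : Source.accessPointFading r ∈ S) :
    Measurable[netSigma X h S] fun ω => (netLink X h r ω).2 :=
  @Measurable.prodMk _ (netSigma X h S) _ _ _ _ (fun ω => (netLink X h r ω).2.1)
    (fun ω => (netLink X h r ω).2.2) (measurable_netSigma_sensors h1 h2)
    (measurable_netSigma_accessPoints h3 h4)

omit mΩ in
lemma measurable_netSigma_netLink {S : Set Source} {r : Receiver}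
    (hS : ∀ s : Source, s.receiver = some r → s ∈ S) :
    Measurable[netSigma X h S] (netLink X h r) :=
  @Measurable.prodMk _ (netSigma X h S) _ _ _ _ (h (signalChannel r))
    (fun ω => (netLink X h r ω).2)
    (measurable_netSigma_fading (hS _ (by rw [source_signalChannel]; rfl)))
    (measurable_netSigma_interference (hS _ rfl) (hS _ rfl) (hS _ rfl) (hS _ rfl))

namespace IsSensorNetwork

variable (hnet : IsSensorNetwork P 1 lamS rhoS lamAP rhoAP lamE X h)
include hnet

lemma iIndep_elementSigma : iIndep (elementSigma X h) P := by
  refine iIndep_sumElim hnet.indep_locations.iIndep hnet.indep_fading.iIndep ?_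
  have := (IndepFun_iff_Indep _ _ _).1 hnet.indep_locations_fading
  refine indep_of_indep_of_le_left (indep_of_indep_of_le_right this ?_) ?_
  · refine iSup_le fun c => Measurable.comap_le ?_
    exact (measurable_pi_apply c).comp (comap_measurable fun ω c => h c ω)
  · refine iSup_le fun p => Measurable.comap_le ?_
    exact (measurable_pi_apply p).comp (comap_measurable fun ω p => X p ω)

/-- Independence claims between parts of the network are reduced here to disjointness of two sets of
labels. -/
lemma indepFun_of_disjoint {S T : Set Source} (hST : Disjoint S T) {A B : Type*}
    [MeasurableSpace A] [MeasurableSpace B] {f : Ω → A} {g : Ω → B}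
    (hf : Measurable[netSigma X h S] f) (hg : Measurable[netSigma X h T] g) : IndepFun f g P := by
  have hle : ∀ i, elementSigma X h i ≤ mΩ := by
    rintro (p | c)
    · exact (hnet.hppp p).measurable.comap_le
    · exact (hnet.fading_measurable c).comap_le
  have := indep_iSup_of_disjoint hle hnet.iIndep_elementSigma (hST.preimage source)
  rw [IndepFun_iff_Indep]
  exact indep_of_indep_of_le_left (indep_of_indep_of_le_right this hg.comap_le) hf.comap_le

lemma isLink_netLink (r : Receiver) :
    IsLink P (netLink X h r) (lamS * rhoS) (lamAP * rhoAP) where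
  measurable_signal := hnet.fading_measurable _
  law_signal := hnet.fading_law _
  sensors :=
    { hppp := hnet.hppp (Proc.activeSensor r)
      measurable_marks := fun i => hnet.fading_measurable _
      law_marks := fun i => hnet.fading_law _
      indep_marks := hnet.indep_fading.precomp (sensorChannel_injective r)
      indep := hnet.indepFun_of_disjoint (S := {Source.sensors r}) (T := {Source.sensorFading r})
        (by simp) (measurable_netSigma_location rfl)
        (@measurable_pi_lambda _ _ _ (netSigma X h _) _ _
          fun i => measurable_netSigma_fading (source_sensorChannel r i)) }
  accessPoints :=
    { hppp := hnet.hppp (Proc.activeAP r)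
      measurable_marks := fun i => hnet.fading_measurable _
      law_marks := fun i => hnet.fading_law _
      indep_marks := hnet.indep_fading.precomp (accessPointChannel_injective r)
      indep := hnet.indepFun_of_disjoint (S := {Source.accessPoints r})
        (T := {Source.accessPointFading r}) (by simp) (measurable_netSigma_location rfl)
        (@measurable_pi_lambda _ _ _ (netSigma X h _) _ _
          fun i => measurable_netSigma_fading (source_accessPointChannel r i)) }
  indep_signal :=
    hnet.indepFun_of_disjoint (S := {Source.signal r}) (T := {Source.signal r}ᶜ)
      disjoint_compl_right (measurable_netSigma_fading (source_signalChannel r))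
      (measurable_netSigma_interference (by simp) (by simp) (by simp) (by simp))
  indep_interference :=
    hnet.indepFun_of_disjoint (S := {Source.sensors r, Source.sensorFading r})
      (T := {Source.accessPoints r, Source.accessPointFading r}) (by simp)
      (measurable_netSigma_sensors (by simp) (by simp))
      (measurable_netSigma_accessPoints (by simp) (by simp))

end IsSensorNetwork

end

/-! ### The nearest point of a Poisson process -/

@[fun_prop]
lemma measurable_nearestPoint : Measurable nearestPoint := by
  classical
  let E : Set (ℕ → Plane) := {x | ∃ i, ∀ j, ‖x i‖ ≤ ‖x j‖}
  have hmin : ∀ i, MeasurableSet {x : ℕ → Plane | ∀ j, ‖x i‖ ≤ ‖x j‖} := by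
    intro i
    rw [Set.ofPred_forall]
    exact .iInter fun j => measurableSet_le (by fun_prop) (by fun_prop)
  have hE : MeasurableSet E := by
    have : E = ⋃ i, {x : ℕ → Plane | ∀ j, ‖x i‖ ≤ ‖x j‖} := by ext; simp [E]
    rw [this]
    exact .iUnion hmin
  -- Where no minimum exists the condition is vacuous, so the search always succeeds and returns
  -- index 0, the default in `nearestPoint`.
  have hex : ∀ x : ℕ → Plane, ∃ i, x ∈ E → ∀ j, ‖x i‖ ≤ ‖x j‖ := by
    intro x
    by_cases hx : x ∈ E
    · obtain ⟨i, hi⟩ := hx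
      exact ⟨i, fun _ => hi⟩
    · exact ⟨0, fun h => absurd h hx⟩
  have hm := Measurable.find (f := fun (i : ℕ) (x : ℕ → Plane) => x i)
    (p := fun i x => x ∈ E → ∀ j, ‖x i‖ ≤ ‖x j‖) (fun i => measurable_pi_apply i)
    (fun i => by
      have : {x : ℕ → Plane | x ∈ E → ∀ j, ‖x i‖ ≤ ‖x j‖} = Eᶜ ∪ {x | ∀ j, ‖x i‖ ≤ ‖x j‖} := by
        ext x
        simp [imp_iff_not_or]
      rw [this]
      exact hE.compl.union (hmin i)) hex
  convert hm using 1
  ext1 x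
  unfold nearestPoint
  by_cases hx : ∃ i, ∀ j, ‖x i‖ ≤ ‖x j‖
  · rw [dif_pos hx]
    congr 1
    refine Nat.find_congr' fun {i} => ?_
    exact ⟨fun h _ => h, fun h => h hx⟩
  · rw [dif_neg hx]
    congr 1
    rw [eq_comm, Nat.find_eq_zero]
    exact fun h => absurd h hx

section

variable {Ω : Type*} [MeasurableSpace Ω] {P : Measure Ω} [IsProbabilityMeasure P]

namespace IsHPPP

variable {X : Ω → ℕ → Plane} {lam : ℝ} (hX : IsHPPP P X lam)
include hX

lemma ae_pointCount_ne_top {B : Set Plane} (hB : MeasurableSet B) (hB' : volume B ≠ ⊤) :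
    ∀ᵐ ω ∂P, pointCount (X ω) B ≠ ⊤ := by
  have hN : Measurable fun ω => pointCount (X ω) B := (measurable_pointCount hB).comp hX.measurable
  have h : P.map (fun ω => pointCount (X ω) B) {⊤} = 0 := by
    rw [map_eq_map_natCast_poissonMeasure hN (hX.count_law B hB hB'),
      Measure.map_apply measurable_from_top (measurableSet_singleton _)]
    have : (fun n : ℕ => (n : ℕ∞)) ⁻¹' {⊤} = ∅ := by
      ext n
      simp
    rw [this, measure_empty]
  rw [Measure.map_apply hN (measurableSet_singleton _)] at h
  simpa [ae_iff] using! h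

/-- A single point has area zero. For z = 0 this keeps the receivers away from the typical sensor,
where the path loss of the signal would be infinite. -/
lemma ae_forall_ne (hlam : 0 ≤ lam) (z : Plane) : ∀ᵐ ω ∂P, ∀ i, X ω i ≠ z := by
  have h := hX.prob_forall_notMem hlam (measurableSet_singleton z)
  have hm : MeasurableSet {ω | ∀ i, X ω i ∉ ({z} : Set Plane)} := by
    rw [Set.ofPred_forall]
    exact .iInter fun i =>
      ((measurable_pi_apply i).comp hX.measurable) (measurableSet_singleton z).compl
  rw [measure_singleton, mul_zero, expNeg_zero] at h
  exact (prob_compl_eq_zero_iff hm).2 h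

/-- Almost surely there is a point nearest to the origin. -/
lemma ae_exists_norm_le : ∀ᵐ ω ∂P, ∃ i, ∀ j, ‖X ω i‖ ≤ ‖X ω j‖ := by
  have h : ∀ᵐ ω ∂P, ∀ n : ℕ, pointCount (X ω) (Metric.closedBall 0 n) ≠ ⊤ :=
    ae_all_iff.2 fun n => hX.ae_pointCount_ne_top Metric.isClosed_closedBall.measurableSet
      measure_closedBall_lt_top.ne
  filter_upwards [h] with ω hω
  -- The ball contains the point of index 0, so the finite set to be minimised over is nonempty.
  obtain ⟨n, hn⟩ := exists_nat_ge ‖X ω 0‖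
  have hfin : {i | X ω i ∈ Metric.closedBall (0 : Plane) n}.Finite :=
    Set.encard_ne_top_iff.1 (hω n)
  obtain ⟨i, hi, hmin⟩ := Set.exists_min_image _ (fun i => ‖X ω i‖) hfin ⟨0, by simpa using hn⟩
  refine ⟨i, fun j => ?_⟩
  by_cases hj : X ω j ∈ Metric.closedBall (0 : Plane) n
  · exact hmin j hj
  · simp only [Set.mem_ofPred_eq, Metric.mem_closedBall, dist_zero_right, not_le] at hi hj
    exact hi.trans hj.le

/-- When a nearest point exists, its squared distance exceeds t exactly if the closed disc of area
πt is empty, so this is a void probability. -/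
lemma prob_lt_norm_nearestPoint (hlam : 0 ≤ lam) {t : ℝ} (ht : 0 ≤ t) :
    P {ω | t < ‖nearestPoint (X ω)‖ ^ 2} = ENNReal.ofReal (Real.exp (-(Real.pi * lam * t))) := by
  have hpi := Real.pi_pos
  have hB : MeasurableSet (Metric.closedBall (0 : Plane) (√t)) :=
    Metric.isClosed_closedBall.measurableSet
  have h := hX.prob_forall_notMem hlam hB
  rw [EuclideanSpace.volume_closedBall_fin_two, ← ENNReal.ofReal_pow (Real.sqrt_nonneg t),
    Real.sq_sqrt ht, ← ENNReal.ofReal_mul ht, ← ENNReal.ofReal_mul hlam,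
    expNeg_ofReal (by positivity)] at h
  have he : lam * (t * Real.pi) = Real.pi * lam * t := by ring
  rw [← he, ← h]
  refine measure_congr ?_
  filter_upwards [hX.ae_exists_norm_le] with ω hω
  have hnear : ∃ i, nearestPoint (X ω) = X ω i ∧ ∀ j, ‖X ω i‖ ≤ ‖X ω j‖ := by
    classical
    refine ⟨Nat.find hω, ?_, Nat.find_spec hω⟩
    unfold nearestPoint
    rw [dif_pos hω]
  obtain ⟨i, hi, hmin⟩ := hnear
  refine propext ?_
  change t < ‖nearestPoint (X ω)‖ ^ 2 ↔ ∀ j, X ω j ∉ Metric.closedBall (0 : Plane) (√t)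
  have hiff : ∀ j, X ω j ∉ Metric.closedBall (0 : Plane) (√t) ↔ t < ‖X ω j‖ ^ 2 := by
    intro j
    rw [Metric.mem_closedBall, dist_zero_right, Real.le_sqrt (norm_nonneg _) ht, not_le]
  simp_rw [hiff, hi]
  exact ⟨fun h j => h.trans_le (by gcongr; exact hmin j), fun h => h i⟩

/-- The Laplace transform of the squared distance from the origin to the nearest point. -/
lemma lintegral_expNeg_norm_nearestPoint (hlam : 0 < lam) {c : ℝ} (hc : 0 < c) :
    ∫⁻ ω, expNeg (ENNReal.ofReal (c * ‖nearestPoint (X ω)‖ ^ 2)) ∂P =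
      ENNReal.ofReal (Real.pi * lam / (c + Real.pi * lam)) := by
  have hpi := Real.pi_pos
  have hm := hX.measurable
  have hT : Measurable fun ω => ‖nearestPoint (X ω)‖ ^ 2 := by fun_prop
  have hint : ∀ T : ℝ, ∫ t in (0)..T, c * Real.exp (-(c * t)) = 1 - Real.exp (-(c * T)) := by
    intro T
    rw [intervalIntegral.integral_eq_sub_of_hasDerivAt (f := fun t => -Real.exp (-(c * t)))]
    · simp
      ring
    · intro t _
      have := (((hasDerivAt_id t).const_mul c).neg.exp).neg
      simpa [mul_comm] using! this
    · exact (by fun_prop : Continuous fun t => c * Real.exp (-(c * t))).intervalIntegrable _ _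
  -- Layer cake for the squared distance T: the mean of 1 - exp(-cT) is the integral of P(T > t) c
  -- exp(-ct). The transform itself is the complement to 1.
  have hlayer := lintegral_comp_eq_lintegral_meas_lt_mul P
    (f := fun ω => ‖nearestPoint (X ω)‖ ^ 2) (g := fun t => c * Real.exp (-(c * t)))
    (.of_forall fun ω => sq_nonneg _) hT.aemeasurable
    (fun t _ => (by fun_prop : Continuous fun t => c * Real.exp (-(c * t))).intervalIntegrable _ _)
    (.of_forall fun t => by positivity)
  simp_rw [hint] at hlayer
  have hright : ∫⁻ t in Set.Ioi (0 : ℝ), P {ω | t < ‖nearestPoint (X ω)‖ ^ 2} *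
      ENNReal.ofReal (c * Real.exp (-(c * t))) = ENNReal.ofReal (c / (c + Real.pi * lam)) := by
    rw [setLIntegral_congr_fun (g := fun t => ENNReal.ofReal c *
      ENNReal.ofReal (Real.exp (-((c + Real.pi * lam) * t)))) measurableSet_Ioi]
    · rw [lintegral_const_mul _ (by fun_prop), lintegral_exp_neg_mul_Ioi (by positivity), mul_zero,
        neg_zero, Real.exp_zero, ← ENNReal.ofReal_mul hc.le, mul_one_div]
    · intro t ht
      have ht : 0 < t := ht
      simp only
      rw [hX.prob_lt_norm_nearestPoint hlam.le ht.le, ← ENNReal.ofReal_mul (by positivity),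
        ← ENNReal.ofReal_mul (by positivity), mul_left_comm, ← Real.exp_add]
      congr 3
      ring
  rw [hright] at hlayer
  have hsum : ∫⁻ ω, expNeg (ENNReal.ofReal (c * ‖nearestPoint (X ω)‖ ^ 2)) ∂P +
      ENNReal.ofReal (c / (c + Real.pi * lam)) = 1 := by
    rw [← hlayer, ← lintegral_add_left (by fun_prop)]
    have : ∀ ω, expNeg (ENNReal.ofReal (c * ‖nearestPoint (X ω)‖ ^ 2)) +
        ENNReal.ofReal (1 - Real.exp (-(c * ‖nearestPoint (X ω)‖ ^ 2))) = 1 := by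
      intro ω
      have h0 : 0 ≤ c * ‖nearestPoint (X ω)‖ ^ 2 := by positivity
      rw [expNeg_ofReal h0, ← ENNReal.ofReal_add (Real.exp_pos _).le
        (sub_nonneg.2 (Real.exp_le_one_iff.2 (by linarith)))]
      simp
    simp [this]
  rw [ENNReal.eq_sub_of_add_eq ENNReal.ofReal_ne_top hsum, ← ENNReal.ofReal_one,
    ← ENNReal.ofReal_sub _ (by positivity)]
  congr 1
  field_simp
  ring

end IsHPPP

lemma lintegral_expNeg_norm_sq {c : ℝ} (hc : 0 < c) :
    ∫⁻ y : Plane, expNeg (ENNReal.ofReal (c * ‖y‖ ^ 2)) = ENNReal.ofReal (Real.pi / c) := by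
  rw [lintegral_norm_sq (g := fun u => expNeg (ENNReal.ofReal (c * u)))
    (fun r => EuclideanSpace.volume_closedBall_fin_two 0 r) (by fun_prop),
    setLIntegral_congr_fun (g := fun u => ENNReal.ofReal (Real.exp (-(c * u)))) measurableSet_Ioi,
    lintegral_exp_neg_mul_Ioi hc, mul_zero, neg_zero, Real.exp_zero,
    ← ENNReal.ofReal_mul Real.pi_pos.le, mul_one_div]
  intro u hu
  have hu : 0 < u := hu
  exact expNeg_ofReal (by positivity)

end

/-! ### Reduction of the single-antenna network to links -/

/-- A unit vector with one entry is a phase. The entry of u must not vanish, since `unitVec` sends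
the zero vector to itself. -/
lemma power_unitVec_dotProduct {u : Fin 1 → ℂ} (hu : u 0 ≠ 0) (g : Fin 1 → ℂ) :
    power (star (unitVec u) ⬝ᵥ g) = power (g 0) := by
  have hn : ‖WithLp.toLp 2 u‖ = ‖u 0‖ := by simp [EuclideanSpace.norm_eq]
  have hu' : ‖u 0‖ ≠ 0 := norm_ne_zero_iff.2 hu
  simp [power, dotProduct, unitVec, hn, hu']

lemma power_dotProduct_unitVec {u : Fin 1 → ℂ} (hu : u 0 ≠ 0) (g : Fin 1 → ℂ) :
    power (g ⬝ᵥ star (unitVec u)) = power (g 0) := by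
  rw [dotProduct_comm, power_unitVec_dotProduct hu]

/-- The signal-to-interference ratio at the typical access point. -/
noncomputable def sirAP {Ω : Type*} (alpha mu : ℝ) (X : Proc → Ω → ℕ → Plane)
    (h : Channel 1 → Ω → ℂ) (ω : Ω) : ℝ≥0∞ :=
  linkSIR alpha mu (nearestPoint (X Proc.idleAP ω)) (netLink X h Receiver.ap ω)

/-- The signal-to-interference ratio at the most detrimental eavesdropper. -/
noncomputable def sirEve {Ω : Type*} (alpha mu : ℝ) (X : Proc → Ω → ℕ → Plane)
    (h : Channel 1 → Ω → ℂ) (ω : Ω) : ℝ≥0∞ :=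
  ⨆ k, linkSIR alpha mu (X Proc.eavesdropper ω k) (netLink X h (Receiver.eve k) ω)

namespace IsSensorNetwork

variable {Ω : Type*} [mΩ : MeasurableSpace Ω] {P : Measure Ω} [IsProbabilityMeasure P]
  {lamS rhoS lamAP rhoAP lamE : ℝ} {X : Proc → Ω → ℕ → Plane} {h : Channel 1 → Ω → ℂ}

section

variable (hnet : IsSensorNetwork P 1 lamS rhoS lamAP rhoAP lamE X h)
include hnet

lemma ae_fading_ne_zero (c : Channel 1) : ∀ᵐ ω ∂P, h c ω ≠ 0 := by
  have h1 := prob_lt_power 0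
  rw [expNeg_zero, ← hnet.fading_law c, Measure.map_apply (hnet.fading_measurable c)
    (measurableSet_lt measurable_const measurable_power)] at h1
  have h2 := (prob_compl_eq_zero_iff (hnet.fading_measurable c
    (measurableSet_lt measurable_const measurable_power))).2 h1
  have h3 : ∀ᵐ ω ∂P, 0 < power (h c ω) := h2
  filter_upwards [h3] with ω hω h0
  simp [power, h0] at hω

/-- The combiner and the beamformers are phases off the null set where a coefficient that determines
one of them vanishes. -/
lemma sinrAP_ae_eq (alpha mu : ℝ) : sinrAP alpha mu 0 X h =ᵐ[P] sirAP alpha mu X h := by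
  filter_upwards [hnet.ae_fading_ne_zero (Channel.sensorAP 0),
    ae_all_iff.2 fun j => hnet.ae_fading_ne_zero (Channel.apSink Receiver.ap j 0)] with ω h0 h1
  have hS : ENNReal.ofReal (‖WithLp.toLp 2 (sensorVec h ω)‖ ^ 2) =
      power (h (Channel.sensorAP 0) ω) := by
    simp [EuclideanSpace.norm_eq, power, sensorVec]
  rw [sinrAP, sirAP, linkSIR, hS, ENNReal.ofReal_zero, add_zero, interfSensorsAP, interfAPsAP]
  have h0' : sensorVec h ω 0 ≠ 0 := h0
  have h1' : ∀ j, sinkVec h Receiver.ap j ω 0 ≠ 0 := h1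
  have hmv : ∀ j, Matrix.mulVec (Matrix.of fun m n => h (Channel.interfAPAP j m n) ω)
      (star (unitVec (sinkVec h Receiver.ap j ω))) 0 =
      (fun n => h (Channel.interfAPAP j 0 n) ω) ⬝ᵥ star (unitVec (sinkVec h Receiver.ap j ω)) :=
    fun j => rfl
  simp_rw [power_unitVec_dotProduct h0', hmv, fun j => power_dotProduct_unitVec (h1' j)]
  rfl

lemma sinrEve_ae_eq (alpha mu : ℝ) : sinrEve alpha mu 0 X h =ᵐ[P] sirEve alpha mu X h := by
  filter_upwards [ae_all_iff.2 fun k => ae_all_iff.2 fun j =>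
    hnet.ae_fading_ne_zero (Channel.apSink (Receiver.eve k) j 0)] with ω h1
  have h1' : ∀ k j, sinkVec h (Receiver.eve k) j ω 0 ≠ 0 := h1
  rw [sinrEve, sirEve]
  refine iSup_congr fun k => ?_
  rw [sinrEveAt, linkSIR, ENNReal.ofReal_zero, add_zero, interfSensorsEve, interfAPsEve]
  simp_rw [fun j => power_dotProduct_unitVec (h1' k j), mul_assoc, ENNReal.tsum_mul_left]
  rfl

end

/-! ### Laws of the two signal-to-interference ratios -/

omit mΩ in
lemma measurable_netSigma_sirAP (alpha mu : ℝ) {S : Set Source} (h1 : Source.idleAPs ∈ S)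
    (h2 : ∀ s : Source, s.receiver = some Receiver.ap → s ∈ S) :
    Measurable[netSigma X h S] (sirAP alpha mu X h) :=
  @measurable_linkSIR Ω (netSigma X h S) alpha mu _ _
    (measurable_nearestPoint.comp (measurable_netSigma_location h1))
    (measurable_netSigma_netLink h2)

omit mΩ in
lemma measurable_netSigma_sirEve (alpha mu : ℝ) {S : Set Source} (h1 : Source.eavesdroppers ∈ S)
    (h2 : ∀ k, ∀ s : Source, s.receiver = some (Receiver.eve k) → s ∈ S) :
    Measurable[netSigma X h S] (sirEve alpha mu X h) :=
  Measurable.iSup fun k =>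
    @measurable_linkSIR Ω (netSigma X h S) alpha mu _ _
      ((measurable_pi_apply k).comp (measurable_netSigma_location h1))
      (measurable_netSigma_netLink (h2 k))

variable (hnet : IsSensorNetwork P 1 lamS rhoS lamAP rhoAP lamE X h)
include hnet

omit [IsProbabilityMeasure P] in
lemma netSigma_le (S : Set Source) : netSigma X h S ≤ mΩ := by
  refine iSup₂_le ?_
  rintro (p | c) -
  · exact (hnet.hppp p).measurable.comap_le
  · exact (hnet.fading_measurable c).comap_le

omit [IsProbabilityMeasure P] in
lemma measurable_sirAP (alpha mu : ℝ) : Measurable (sirAP alpha mu X h) :=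
  (measurable_netSigma_sirAP alpha mu (S := Set.univ) (by simp) (by simp)).mono
    (hnet.netSigma_le _) le_rfl

omit [IsProbabilityMeasure P] in
lemma measurable_sirEve (alpha mu : ℝ) : Measurable (sirEve alpha mu X h) :=
  (measurable_netSigma_sirEve alpha mu (S := Set.univ) (by simp) (by simp)).mono
    (hnet.netSigma_le _) le_rfl

omit [IsProbabilityMeasure P] in
-- Here it matters that each receiver has its own interferers: no label is shared between the access
-- point and the eavesdroppers.
lemma indepFun_sirEve_sirAP (alpha mu : ℝ) :
    IndepFun (sirEve alpha mu X h) (sirAP alpha mu X h) P :=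
  hnet.indepFun_of_disjoint
    (S := {s | s = Source.eavesdroppers ∨ ∃ k, s.receiver = some (Receiver.eve k)})
    (T := {s | s = Source.idleAPs ∨ s.receiver = some Receiver.ap})
    (Set.disjoint_left.2 fun s hs ht => by
      rcases hs with rfl | ⟨k, hk⟩ <;> rcases ht with ht | ht <;> simp_all [Source.receiver])
    (measurable_netSigma_sirEve alpha mu (Or.inl rfl) fun k s hs => Or.inr ⟨k, hs⟩)
    (measurable_netSigma_sirAP alpha mu (Or.inl rfl) fun s hs => Or.inr hs)

variable (hlamS : 0 < lamS) (hrhoS : 0 < rhoS) (hlamAP : 0 < lamAP) (hrhoAP : 0 < rhoAP)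
  (hrhoAP' : rhoAP < 1) (hlamE : 0 < lamE) {alpha mu : ℝ} (halpha : 2 < alpha) (hmu : 0 < mu)
include hlamS hrhoS hlamAP hrhoAP halpha hmu

omit hnet [IsProbabilityMeasure P] mΩ in
lemma _root_.Lambda1_pos : 0 < Lambda1 lamS rhoS lamAP rhoAP mu alpha := by
  have hpi := Real.pi_pos
  have hG1 : 0 < Real.Gamma (1 + 2 / alpha) := Real.Gamma_pos_of_pos (by positivity)
  have hG2 : 0 < Real.Gamma (1 - 2 / alpha) :=
    Real.Gamma_pos_of_pos (by rw [sub_pos, div_lt_one (by linarith)]; exact halpha)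
  unfold Lambda1
  positivity

include hrhoAP' in
/-- The tail of the signal-to-interference ratio at the typical access point. -/
lemma prob_lt_sirAP {x : ℝ} (hx : 0 < x) :
    P {ω | ENNReal.ofReal x < sirAP alpha mu X h ω} =
      ENNReal.ofReal (Real.pi * (lamAP * (1 - rhoAP)) /
        (Lambda1 lamS rhoS lamAP rhoAP mu alpha * x ^ (2 / alpha) +
          Real.pi * (lamAP * (1 - rhoAP)))) := by
  have hL := Lambda1_pos hlamS hrhoS hlamAP hrhoAP halpha hmu
  have hlam : 0 < lamAP * (1 - rhoAP) := mul_pos hlamAP (by linarith)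
  have hV := hnet.hppp Proc.idleAP
  simp only [intensity] at hV
  have hN := hnet.isLink_netLink Receiver.ap
  let F : (ℕ → Plane) × Link → ℝ≥0∞ :=
    {p | ENNReal.ofReal x < linkSIR alpha mu (nearestPoint p.1) p.2}.indicator 1
  have hF : Measurable F :=
    measurable_one.indicator (measurableSet_lt (by fun_prop) (by fun_prop))
  have hind : IndepFun (X Proc.idleAP) (netLink X h Receiver.ap) P :=
    hnet.indepFun_of_disjoint (S := {Source.idleAPs})
      (T := {s | s.receiver = some Receiver.ap}) (by simp [Source.receiver])
      (measurable_netSigma_location rfl) (measurable_netSigma_netLink fun s hs => hs)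
  have hcond := lintegral_indepFun_prod hV.measurable hN.measurable hind hF
  have hleft : ∫⁻ ω, F (X Proc.idleAP ω, netLink X h Receiver.ap ω) ∂P =
      P {ω | ENNReal.ofReal x < sirAP alpha mu X h ω} := by
    rw [← lintegral_indicator_one
      (measurableSet_lt measurable_const (hnet.measurable_sirAP alpha mu))]
    rfl
  -- Given the position of the access point, the tail is `expNeg` of Λ₁ x^(2/α) times its squared
  -- norm; the average is a value of the Laplace transform of that squared norm.
  rw [← hleft, hcond, ← hV.lintegral_expNeg_norm_nearestPoint hlam (by positivity)]
  refine lintegral_congr_ae ?_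
  filter_upwards [hV.ae_forall_ne hlam.le 0] with ω hω
  have hz : nearestPoint (X Proc.idleAP ω) ≠ 0 := by
    unfold nearestPoint
    split_ifs <;> exact hω _
  rw [← hN.prob_lt_linkSIR (by positivity) (by positivity) halpha hmu hz hx,
    ← lintegral_indicator_one
      (measurableSet_lt measurable_const (measurable_linkSIR _ _ measurable_const hN.measurable))]
  rfl

include hlamE in
/-- The distribution function of the signal-to-interference ratio at the most detrimental
eavesdropper. -/
lemma prob_sirEve_le {x : ℝ} (hx : 0 < x) :
    P {ω | sirEve alpha mu X h ω ≤ ENNReal.ofReal x} =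
      ENNReal.ofReal (Real.exp (-(Real.pi * lamE /
        (Lambda1 lamS rhoS lamAP rhoAP mu alpha * x ^ (2 / alpha))))) := by
  have hpi := Real.pi_pos
  have hL := Lambda1_pos hlamS hrhoS hlamAP hrhoAP halpha hmu
  have hV := hnet.hppp Proc.eavesdropper
  simp only [intensity] at hV
  have hN := fun k => hnet.isLink_netLink (Receiver.eve k)
  set c := Lambda1 lamS rhoS lamAP rhoAP mu alpha * x ^ (2 / alpha) with hc
  have hc0 : 0 < c := by positivity
  -- W is ∞ for an eavesdropper whose ratio exceeds x and 0 otherwise, so `expNeg` of the sum of W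
  -- is the indicator that none exceeds x.
  let W : Plane × Link → ℝ≥0∞ :=
    {p | ENNReal.ofReal x < linkSIR alpha mu p.1 p.2}.indicator fun _ => ⊤
  have hWset : MeasurableSet {p : Plane × Link | ENNReal.ofReal x < linkSIR alpha mu p.1 p.2} :=
    measurableSet_lt (by fun_prop) (by fun_prop)
  have hW : Measurable W := measurable_const.indicator hWset
  have hWle : ∀ p, W p = 0 ↔ linkSIR alpha mu p.1 p.2 ≤ ENNReal.ofReal x := by
    intro p
    simp [W]
  have hWtop : ∀ p, W p ≠ 0 → W p = ⊤ := by
    intro p hp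
    simp_all [W]
  let F : (ℕ → Plane) × (ℕ → Link) → ℝ≥0∞ := fun p => expNeg (∑' k, W (p.1 k, p.2 k))
  have hF : Measurable F := measurable_expNeg.comp (Measurable.tsum fun k => by fun_prop)
  have hind : IndepFun (X Proc.eavesdropper) (fun ω k => netLink X h (Receiver.eve k) ω) P :=
    hnet.indepFun_of_disjoint (S := {Source.eavesdroppers})
      (T := {Source.eavesdroppers}ᶜ) disjoint_compl_right
      (measurable_netSigma_location rfl)
      (@measurable_pi_lambda _ _ _ (netSigma X h _) _ _ fun k =>
        measurable_netSigma_netLink fun s hs => by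
          rintro rfl
          simp [Source.receiver] at hs)
  have hcond := lintegral_indepFun_prod hV.measurable
    (measurable_pi_lambda _ fun k => (hN k).measurable) hind hF
  have hleft : ∫⁻ ω, F (X Proc.eavesdropper ω, fun k => netLink X h (Receiver.eve k) ω) ∂P =
      P {ω | sirEve alpha mu X h ω ≤ ENNReal.ofReal x} := by
    rw [← lintegral_indicator_one
      (measurableSet_le (hnet.measurable_sirEve alpha mu) measurable_const)]
    refine lintegral_congr fun ω => ?_
    by_cases hω : sirEve alpha mu X h ω ≤ ENNReal.ofReal x
    · rw [Set.indicator_of_mem (show ω ∈ {a | sirEve alpha mu X h a ≤ ENNReal.ofReal x} from hω)]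
      have : ∀ k, W (X Proc.eavesdropper ω k, netLink X h (Receiver.eve k) ω) = 0 := fun k =>
        (hWle _).2 (iSup_le_iff.1 hω k)
      simp [F, this]
    · rw [Set.indicator_of_notMem (show ω ∉ {a | sirEve alpha mu X h a ≤ ENNReal.ofReal x} from hω)]
      simp only [sirEve, iSup_le_iff, not_forall] at hω
      obtain ⟨k, hk⟩ := hω
      have hk' : W (X Proc.eavesdropper ω k, netLink X h (Receiver.eve k) ω) = ⊤ :=
        hWtop _ (mt (hWle _).1 hk)
      have : ∑' k, W (X Proc.eavesdropper ω k, netLink X h (Receiver.eve k) ω) = ⊤ :=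
        ENNReal.tsum_eq_top_of_eq_top ⟨k, hk'⟩
      simp [F, this]
  have hinner : ∀ᵐ ω ∂P, ∫⁻ ω', F (X Proc.eavesdropper ω,
      fun k => netLink X h (Receiver.eve k) ω') ∂P =
      expNeg (∑' k, negLog (1 - expNeg (ENNReal.ofReal (c * ‖X Proc.eavesdropper ω k‖ ^ 2)))) := by
    filter_upwards [hV.ae_forall_ne hlamE.le 0] with ω hω
    have hWm : ∀ k, Measurable fun ω' =>
        W (X Proc.eavesdropper ω k, netLink X h (Receiver.eve k) ω') :=
      fun k => hW.comp (measurable_const.prodMk (hN k).measurable)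
    -- With the positions frozen, different eavesdroppers depend on disjoint groups, so the
    -- probability factorises over k.
    have h1 := lintegral_expNeg_tsum (P := P)
      (W := fun k ω' => W (X Proc.eavesdropper ω k, netLink X h (Receiver.eve k) ω')) hWm
      fun n => hnet.indepFun_of_disjoint
        (S := {s | ∃ i < n, s.receiver = some (Receiver.eve i)})
        (T := {s | s.receiver = some (Receiver.eve n)})
        (Set.disjoint_left.2 fun s ⟨i, hi, hs⟩ ht => by
          rw [Set.mem_ofPred_eq, hs] at ht
          simp only [Option.some.injEq, Receiver.eve.injEq] at ht
          omega)
        (@Finset.measurable_fun_sum _ _ _ _ _ _ (netSigma X h _) _ _ fun i hi =>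
          hW.comp (@Measurable.prodMk _ (netSigma X h _) _ _ _ _ _ _
            (@measurable_const _ _ _ (netSigma X h _) _)
            (measurable_netSigma_netLink fun s hs => ⟨i, Finset.mem_range.1 hi, hs⟩)))
        (hW.comp (@Measurable.prodMk _ (netSigma X h _) _ _ _ _ _ _
            (@measurable_const _ _ _ (netSigma X h _) _)
            (measurable_netSigma_netLink fun s hs => hs)))
    refine h1.trans ?_
    congr 2
    ext1 k
    congr 1
    have hm : MeasurableSet {ω' | ENNReal.ofReal x <
        linkSIR alpha mu (X Proc.eavesdropper ω k) (netLink X h (Receiver.eve k) ω')} :=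
      measurableSet_lt measurable_const (measurable_linkSIR _ _ measurable_const (hN k).measurable)
    rw [hc, ← (hN k).prob_lt_linkSIR (by positivity) (by positivity) halpha hmu (hω k) hx,
      ← prob_compl_eq_one_sub hm, ← lintegral_indicator_one hm.compl]
    refine lintegral_congr fun ω' => ?_
    by_cases h' : ENNReal.ofReal x <
        linkSIR alpha mu (X Proc.eavesdropper ω k) (netLink X h (Receiver.eve k) ω')
    · simp [W, Set.indicator, h']
    · simp [W, Set.indicator, h']
  rw [← hleft, hcond, lintegral_congr_ae hinner,
    hV.laplace hlamE.le (φ := fun y => negLog (1 - expNeg (ENNReal.ofReal (c * ‖y‖ ^ 2))))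
      (by fun_prop)]
  -- The exponent of the Laplace functional is 1 - (1 - p(y)) = p(y), the chance that an
  -- eavesdropper at y exceeds x: those that do form an independent thinning, and the result is its
  -- void probability.
  have hsub : ∀ y : Plane, 1 - expNeg (negLog (1 - expNeg (ENNReal.ofReal (c * ‖y‖ ^ 2)))) =
      expNeg (ENNReal.ofReal (c * ‖y‖ ^ 2)) := by
    intro y
    rw [expNeg_negLog tsub_le_self, ENNReal.sub_sub_cancel ENNReal.one_ne_top (expNeg_le_one _)]
  simp_rw [hsub]
  rw [lintegral_expNeg_norm_sq hc0, ← ENNReal.ofReal_mul hlamE.le, expNeg_ofReal (by positivity)]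
  congr 3
  ring

end IsSensorNetwork

/-! ### The average secrecy rate -/

/-- The derivative of log(1 + x), integrated from e to a. The interval is closed at e and open at a
so that its indicator matches the events γ_e ≤ x and γ_ap > x. -/
lemma ofReal_log_one_add_sub_log {a e : ℝ} (ha : 0 ≤ a) (he : 0 ≤ e) :
    ENNReal.ofReal (max (Real.log (1 + a) - Real.log (1 + e)) 0) =
      ∫⁻ x in Set.Ioi 0, (Set.Ico e a).indicator (fun x => ENNReal.ofReal (1 + x)⁻¹) x := by
  have hset : Set.Ico e a ∩ Set.Ici 0 = Set.Ico e a :=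
    Set.inter_eq_left.2 fun x hx => he.trans hx.1
  rw [restrict_Ioi_eq_restrict_Ici, lintegral_indicator measurableSet_Ico,
    Measure.restrict_restrict measurableSet_Ico, hset]
  rcases le_or_gt e a with h | h
  · have hpos : ∀ x ∈ Set.uIcc e a, 0 < 1 + x := by
      intro x hx
      rw [Set.uIcc_of_le h] at hx
      linarith [hx.1]
    have hint : ∫ x in e..a, (1 + x)⁻¹ = Real.log (1 + a) - Real.log (1 + e) := by
      refine intervalIntegral.integral_eq_sub_of_hasDerivAt (f := fun x => Real.log (1 + x))
        (fun x hx => ?_) ?_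
      · simpa using ((hasDerivAt_id x).const_add 1).log (hpos x hx).ne'
      · exact ContinuousOn.intervalIntegrable (ContinuousOn.inv₀ (by fun_prop)
          fun x hx => (hpos x hx).ne')
    have hii : IntervalIntegrable (fun x : ℝ => (1 + x)⁻¹) volume e a :=
      ContinuousOn.intervalIntegrable (ContinuousOn.inv₀ (by fun_prop) fun x hx => (hpos x hx).ne')
    have hle : Real.log (1 + e) ≤ Real.log (1 + a) := Real.log_le_log (by linarith) (by linarith)
    rw [max_eq_left (sub_nonneg.2 hle), ← hint, intervalIntegral.integral_of_le h,
      ofReal_integral_eq_lintegral_ofReal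
        ((intervalIntegrable_iff_integrableOn_Ioc_of_le h).1 hii)]
    · exact setLIntegral_congr Ico_ae_eq_Ioc.symm
    · refine (ae_restrict_mem measurableSet_Ioc).mono fun x hx => ?_
      exact inv_nonneg.2 (by linarith [hx.1])
  · have hle : Real.log (1 + a) ≤ Real.log (1 + e) := Real.log_le_log (by linarith) (by linarith)
    rw [max_eq_right (sub_nonpos.2 hle), Set.Ico_eq_empty (by simpa using h.le)]
    simp

/-- The exponential is at most 1. On (0, 1] the rest is bounded by 1/K, and beyond 1 by a multiple
of x^(-1 - 2/α), which is integrable. -/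
lemma integrableOn_secrecyIntegrand {lamS rhoS lamAP rhoAP lamE mu alpha : ℝ}
    (hlamS : 0 < lamS) (hrhoS : 0 < rhoS) (hlamAP : 0 < lamAP) (hrhoAP : 0 < rhoAP)
    (hrhoAP' : rhoAP < 1) (hlamE : 0 < lamE) (halpha : 2 < alpha) (hmu : 0 < mu) :
    IntegrableOn (secrecyIntegrand lamS rhoS lamAP rhoAP lamE mu alpha) (Set.Ioi 0) := by
  have hpi := Real.pi_pos
  have hL : 0 < Lambda1 lamS rhoS lamAP rhoAP mu alpha :=
    Lambda1_pos hlamS hrhoS hlamAP hrhoAP halpha hmu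
  have hK : 0 < Real.pi * lamAP * (1 - rhoAP) := mul_pos (by positivity) (by linarith)
  have hmeas : Measurable (secrecyIntegrand lamS rhoS lamAP rhoAP lamE mu alpha) := by
    unfold secrecyIntegrand
    fun_prop
  set L := Lambda1 lamS rhoS lamAP rhoAP mu alpha with hLdef
  set K := Real.pi * lamAP * (1 - rhoAP) with hKdef
  have hb : 0 < 2 / alpha := by positivity
  have hexp : ∀ x : ℝ, 0 < x → Real.exp (-(Real.pi * lamE / (L * x ^ (2 / alpha)))) ≤ 1 := by
    intro x hx
    rw [Real.exp_le_one_iff, neg_nonpos]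
    positivity
  have hnorm : ∀ x : ℝ, 0 < x → ‖secrecyIntegrand lamS rhoS lamAP rhoAP lamE mu alpha x‖ ≤
      1 / ((1 + x) * (L * x ^ (2 / alpha) + K)) := by
    intro x hx
    rw [secrecyIntegrand, ← hLdef, ← hKdef, Real.norm_of_nonneg (by positivity)]
    gcongr
    exact hexp x hx
  rw [← Set.Ioc_union_Ioi_eq_Ioi zero_le_one, integrableOn_union]
  constructor
  · refine Integrable.mono' (g := fun _ => 1 / K) (integrableOn_const (by simp))
      hmeas.aestronglyMeasurable ((ae_restrict_mem measurableSet_Ioc).mono fun x hx => ?_)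
    have hx0 : 0 < x := hx.1
    refine (hnorm x hx0).trans ?_
    gcongr
    have h1 : 0 ≤ L * x ^ (2 / alpha) := by positivity
    nlinarith
  · refine Integrable.mono' (g := fun x => L⁻¹ * x ^ (-1 - 2 / alpha))
      ((integrableOn_Ioi_rpow_of_lt (by linarith) one_pos).const_mul _)
      hmeas.aestronglyMeasurable ((ae_restrict_mem measurableSet_Ioi).mono fun x hx => ?_)
    have hx0 : 0 < x := one_pos.trans hx
    refine (hnorm x hx0).trans ?_
    rw [sub_eq_add_neg, Real.rpow_add hx0, Real.rpow_neg_one, Real.rpow_neg hx0.le, one_div,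
      ← mul_inv, ← mul_inv]
    gcongr ?_⁻¹
    have h1 : 0 < x ^ (2 / alpha) := by positivity
    have h2 : 0 < x * K := by positivity
    have h3 : 0 < L * x ^ (2 / alpha) := by positivity
    nlinarith

namespace IsSensorNetwork

variable {Ω : Type*} [mΩ : MeasurableSpace Ω] {P : Measure Ω} [IsProbabilityMeasure P]
  {lamS rhoS lamAP rhoAP lamE : ℝ} {X : Proc → Ω → ℕ → Plane} {h : Channel 1 → Ω → ℂ}
  (hnet : IsSensorNetwork P 1 lamS rhoS lamAP rhoAP lamE X h)
  (hlamS : 0 < lamS) (hrhoS : 0 < rhoS) (hlamAP : 0 < lamAP) (hrhoAP : 0 < rhoAP)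
  (hrhoAP' : rhoAP < 1) (hlamE : 0 < lamE) {alpha mu : ℝ} (halpha : 2 < alpha) (hmu : 0 < mu)
include hnet hlamS hrhoS hlamAP hrhoAP halpha hmu

include hrhoAP' in
-- The explicit tail tends to 0 as x → ∞ because 2/α > 0.
lemma ae_sirAP_lt_top : ∀ᵐ ω ∂P, sirAP alpha mu X h ω < ⊤ := by
  have hpi := Real.pi_pos
  have hL : 0 < Lambda1 lamS rhoS lamAP rhoAP mu alpha :=
    Lambda1_pos hlamS hrhoS hlamAP hrhoAP halpha hmu
  have hb : 0 < 2 / alpha := by positivity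
  have hlim : Tendsto (fun x : ℝ => ENNReal.ofReal (Real.pi * (lamAP * (1 - rhoAP)) /
        (Lambda1 lamS rhoS lamAP rhoAP mu alpha * x ^ (2 / alpha) +
          Real.pi * (lamAP * (1 - rhoAP))))) atTop (𝓝 0) := by
    rw [← ENNReal.ofReal_zero]
    refine ENNReal.tendsto_ofReal (Tendsto.const_div_atTop ?_ _)
    exact tendsto_atTop_add_const_right _ _ ((tendsto_rpow_atTop hb).const_mul_atTop hL)
  have hle : P {ω | ¬ sirAP alpha mu X h ω < ⊤} ≤ 0 := by
    refine ge_of_tendsto hlim ?_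
    filter_upwards [eventually_gt_atTop 0] with x hx
    rw [← hnet.prob_lt_sirAP hlamS hrhoS hlamAP hrhoAP hrhoAP' halpha hmu hx]
    refine measure_mono fun ω hω => ?_
    exact ENNReal.ofReal_lt_top.trans_le (not_lt.1 hω)
  exact le_antisymm hle bot_le

include hlamE in
-- The explicit distribution function tends to 1 as x → ∞, so even the supremum over infinitely many
-- eavesdroppers is finite.
lemma ae_sirEve_lt_top : ∀ᵐ ω ∂P, sirEve alpha mu X h ω < ⊤ := by
  have hL : 0 < Lambda1 lamS rhoS lamAP rhoAP mu alpha :=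
    Lambda1_pos hlamS hrhoS hlamAP hrhoAP halpha hmu
  have hb : 0 < 2 / alpha := by positivity
  have hlim : Tendsto (fun x : ℝ => ENNReal.ofReal (Real.exp (-(Real.pi * lamE /
        (Lambda1 lamS rhoS lamAP rhoAP mu alpha * x ^ (2 / alpha)))))) atTop (𝓝 1) := by
    have h0 : Tendsto (fun x : ℝ => Real.pi * lamE /
        (Lambda1 lamS rhoS lamAP rhoAP mu alpha * x ^ (2 / alpha))) atTop (𝓝 0) :=
      Tendsto.const_div_atTop ((tendsto_rpow_atTop hb).const_mul_atTop hL) _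
    have h1 := (Real.continuous_exp.tendsto _).comp h0.neg
    rw [neg_zero, Real.exp_zero] at h1
    rw [← ENNReal.ofReal_one]
    exact ENNReal.tendsto_ofReal h1
  have hge : 1 ≤ P {ω | sirEve alpha mu X h ω < ⊤} := by
    refine le_of_tendsto hlim ?_
    filter_upwards [eventually_gt_atTop 0] with x hx
    rw [← hnet.prob_sirEve_le hlamS hrhoS hlamAP hrhoAP hlamE halpha hmu hx]
    refine measure_mono fun ω hω => ?_
    exact lt_of_le_of_lt hω ENNReal.ofReal_lt_top
  exact (prob_compl_eq_zero_iff
    (measurableSet_lt (hnet.measurable_sirEve alpha mu) measurable_const)).2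
    (le_antisymm prob_le_one hge)

include hrhoAP' in
lemma one_sub_sinrCDF_sinrAP {x : ℝ} (hx : 0 < x) :
    1 - sinrCDF P (sinrAP alpha mu 0 X h) x = Real.pi * lamAP * (1 - rhoAP) /
      (Lambda1 lamS rhoS lamAP rhoAP mu alpha * x ^ (2 / alpha) +
        Real.pi * lamAP * (1 - rhoAP)) := by
  have hpi := Real.pi_pos
  have hL : 0 < Lambda1 lamS rhoS lamAP rhoAP mu alpha :=
    Lambda1_pos hlamS hrhoS hlamAP hrhoAP halpha hmu
  have hK : 0 < Real.pi * (lamAP * (1 - rhoAP)) :=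
    mul_pos hpi (mul_pos hlamAP (by linarith))
  have hm : MeasurableSet {ω | sirAP alpha mu X h ω ≤ ENNReal.ofReal x} :=
    measurableSet_le (hnet.measurable_sirAP alpha mu) measurable_const
  have hcongr : sinrCDF P (sinrAP alpha mu 0 X h) x =
      P.real {ω | sirAP alpha mu X h ω ≤ ENNReal.ofReal x} := by
    refine measureReal_congr ?_
    filter_upwards [hnet.sinrAP_ae_eq alpha mu] with ω hω
    refine propext ?_
    change sinrAP alpha mu 0 X h ω ≤ _ ↔ sirAP alpha mu X h ω ≤ _
    rw [hω]
  have hc : {ω | sirAP alpha mu X h ω ≤ ENNReal.ofReal x}ᶜ =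
      {ω | ENNReal.ofReal x < sirAP alpha mu X h ω} := by
    ext ω
    simp
  rw [hcongr, ← probReal_compl_eq_one_sub hm, hc, measureReal_def,
    hnet.prob_lt_sirAP hlamS hrhoS hlamAP hrhoAP hrhoAP' halpha hmu hx,
    ENNReal.toReal_ofReal (by positivity), mul_assoc]

include hlamE in
lemma sinrCDF_sinrEve {x : ℝ} (hx : 0 < x) :
    sinrCDF P (sinrEve alpha mu 0 X h) x = Real.exp (-(Real.pi * lamE /
      (Lambda1 lamS rhoS lamAP rhoAP mu alpha * x ^ (2 / alpha)))) := by
  have hcongr : sinrCDF P (sinrEve alpha mu 0 X h) x =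
      P.real {ω | sirEve alpha mu X h ω ≤ ENNReal.ofReal x} := by
    refine measureReal_congr ?_
    filter_upwards [hnet.sinrEve_ae_eq alpha mu] with ω hω
    refine propext ?_
    change sinrEve alpha mu 0 X h ω ≤ _ ↔ sirEve alpha mu X h ω ≤ _
    rw [hω]
  rw [hcongr, measureReal_def,
    hnet.prob_sirEve_le hlamS hrhoS hlamAP hrhoAP hlamE halpha hmu hx,
    ENNReal.toReal_ofReal (Real.exp_pos _).le]

include hrhoAP' hlamE in
lemma prob_sirEve_le_and_lt_sirAP {x : ℝ} (hx : 0 < x) :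
    P {ω | sirEve alpha mu X h ω ≤ ENNReal.ofReal x ∧ ENNReal.ofReal x < sirAP alpha mu X h ω} *
        ENNReal.ofReal (1 + x)⁻¹ =
      ENNReal.ofReal (Real.pi * lamAP * (1 - rhoAP) *
        secrecyIntegrand lamS rhoS lamAP rhoAP lamE mu alpha x) := by
  have hpi := Real.pi_pos
  have hL : 0 < Lambda1 lamS rhoS lamAP rhoAP mu alpha :=
    Lambda1_pos hlamS hrhoS hlamAP hrhoAP halpha hmu
  have hK : 0 < Real.pi * (lamAP * (1 - rhoAP)) :=
    mul_pos hpi (mul_pos hlamAP (by linarith))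
  have hind := (hnet.indepFun_sirEve_sirAP alpha mu).measure_inter_preimage_eq_mul
    (Set.Iic (ENNReal.ofReal x)) (Set.Ioi (ENNReal.ofReal x)) measurableSet_Iic measurableSet_Ioi
  have h1 : P (sirEve alpha mu X h ⁻¹' Set.Iic (ENNReal.ofReal x)) = _ :=
    hnet.prob_sirEve_le hlamS hrhoS hlamAP hrhoAP hlamE halpha hmu hx
  have h2 : P (sirAP alpha mu X h ⁻¹' Set.Ioi (ENNReal.ofReal x)) = _ :=
    hnet.prob_lt_sirAP hlamS hrhoS hlamAP hrhoAP hrhoAP' halpha hmu hx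
  rw [h1, h2] at hind
  refine (congrArg (· * ENNReal.ofReal (1 + x)⁻¹) hind).trans ?_
  rw [← ENNReal.ofReal_mul (Real.exp_pos _).le, ← ENNReal.ofReal_mul (by positivity),
    secrecyIntegrand, mul_assoc Real.pi lamAP]
  congr 1
  field_simp

include hrhoAP' hlamE in
-- Tonelli applied to the layer representation of the rate. Since the right-hand side is finite,
-- this identity yields integrability of the rate as well as its mean.
lemma lintegral_log_sirAP_sub_log_sirEve :
    ∫⁻ ω, ENNReal.ofReal (max (Real.log (1 + (sirAP alpha mu X h ω).toReal) -
        Real.log (1 + (sirEve alpha mu X h ω).toReal)) 0) ∂P =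
      ENNReal.ofReal (Real.pi * lamAP * (1 - rhoAP) * ∫ x in Set.Ioi (0 : ℝ),
        secrecyIntegrand lamS rhoS lamAP rhoAP lamE mu alpha x) := by
  have hpi := Real.pi_pos
  have hL : 0 < Lambda1 lamS rhoS lamAP rhoAP mu alpha :=
    Lambda1_pos hlamS hrhoS hlamAP hrhoAP halpha hmu
  have hK : 0 < Real.pi * lamAP * (1 - rhoAP) := mul_pos (by positivity) (by linarith)
  have hmA := hnet.measurable_sirAP alpha mu
  have hmE := hnet.measurable_sirEve alpha mu
  let D : Set (Ω × ℝ) := {p | sirEve alpha mu X h p.1 ≤ ENNReal.ofReal p.2 ∧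
    ENNReal.ofReal p.2 < sirAP alpha mu X h p.1}
  have hD : MeasurableSet D :=
    (measurableSet_le (hmE.comp measurable_fst) (by fun_prop)).inter
      (measurableSet_lt (by fun_prop) (hmA.comp measurable_fst))
  let F : Ω → ℝ → ℝ≥0∞ := fun ω x => D.indicator (fun p => ENNReal.ofReal (1 + p.2)⁻¹) (ω, x)
  have hF : Measurable (Function.uncurry F) :=
    Measurable.indicator (f := fun p : Ω × ℝ => ENNReal.ofReal (1 + p.2)⁻¹) (by fun_prop) hD
  have h1 : ∀ᵐ ω ∂P, ENNReal.ofReal (max (Real.log (1 + (sirAP alpha mu X h ω).toReal) -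
        Real.log (1 + (sirEve alpha mu X h ω).toReal)) 0) = ∫⁻ x in Set.Ioi 0, F ω x := by
    -- Finiteness is essential here: `toReal` sends ∞ to 0, which would spoil the comparison with x.
    filter_upwards [hnet.ae_sirAP_lt_top hlamS hrhoS hlamAP hrhoAP hrhoAP' halpha hmu,
      hnet.ae_sirEve_lt_top hlamS hrhoS hlamAP hrhoAP hlamE halpha hmu] with ω hA hE
    rw [ofReal_log_one_add_sub_log ENNReal.toReal_nonneg ENNReal.toReal_nonneg]
    refine setLIntegral_congr_fun measurableSet_Ioi fun x hx => ?_
    have hx : 0 < x := hx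
    have hiff : x ∈ Set.Ico (sirEve alpha mu X h ω).toReal (sirAP alpha mu X h ω).toReal ↔
        (ω, x) ∈ D := by
      change _ ∧ _ ↔ _ ∧ _
      rw [ENNReal.le_ofReal_iff_toReal_le hE.ne hx.le, ENNReal.ofReal_lt_iff_lt_toReal hx.le hA.ne]
    by_cases hxD : (ω, x) ∈ D
    · simp only [F]
      rw [Set.indicator_of_mem hxD, Set.indicator_of_mem (hiff.2 hxD)]
    · simp only [F]
      rw [Set.indicator_of_notMem hxD, Set.indicator_of_notMem (mt hiff.1 hxD)]
  have h2 : ∀ x ∈ Set.Ioi (0 : ℝ), ∫⁻ ω, F ω x ∂P =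
      ENNReal.ofReal (Real.pi * lamAP * (1 - rhoAP) *
        secrecyIntegrand lamS rhoS lamAP rhoAP lamE mu alpha x) := by
    intro x hx
    rw [← hnet.prob_sirEve_le_and_lt_sirAP hlamS hrhoS hlamAP hrhoAP hrhoAP' hlamE halpha hmu hx,
      mul_comm]
    have hs : MeasurableSet {ω | sirEve alpha mu X h ω ≤ ENNReal.ofReal x ∧
        ENNReal.ofReal x < sirAP alpha mu X h ω} :=
      (measurableSet_le hmE measurable_const).inter (measurableSet_lt measurable_const hmA)
    rw [← lintegral_indicator_const hs]
    refine lintegral_congr fun ω => ?_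
    simp only [F, D, Set.indicator, Set.mem_ofPred_eq]
  rw [lintegral_congr_ae h1, lintegral_lintegral_swap hF.aemeasurable,
    setLIntegral_congr_fun measurableSet_Ioi h2, ← integral_const_mul,
    ofReal_integral_eq_lintegral_ofReal]
  · exact (integrableOn_secrecyIntegrand hlamS hrhoS hlamAP hrhoAP hrhoAP' hlamE halpha
      hmu).const_mul _
  · refine (ae_restrict_mem measurableSet_Ioi).mono fun x hx => ?_
    have hx : 0 < x := hx
    simp only [Pi.zero_apply, secrecyIntegrand]
    positivity

omit hlamS hrhoS hlamAP hrhoAP halpha hmu in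
lemma secrecyRate_ae_eq : secrecyRate alpha mu 0 X h =ᵐ[P] fun ω => (Real.log 2)⁻¹ *
    max (Real.log (1 + (sirAP alpha mu X h ω).toReal) -
      Real.log (1 + (sirEve alpha mu X h ω).toReal)) 0 := by
  have h2 : 0 ≤ (Real.log 2)⁻¹ := inv_nonneg.2 (Real.log_nonneg one_le_two)
  filter_upwards [hnet.sinrAP_ae_eq alpha mu, hnet.sinrEve_ae_eq alpha mu] with ω hA hE
  rw [secrecyRate, hA, hE, capacity, capacity, Real.logb, Real.logb, mul_max_of_nonneg _ _ h2,
    mul_zero]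
  congr 1
  ring

end IsSensorNetwork

theorem corollary1 {Ω : Type*} [MeasurableSpace Ω] (P : Measure Ω) [IsProbabilityMeasure P]
    (lamS rhoS lamAP rhoAP lamE Ps Pap alpha : ℝ)
    (hlamS : 0 < lamS) (hrhoS : 0 < rhoS) (hrhoS' : rhoS < 1)
    (hlamAP : 0 < lamAP) (hrhoAP : 0 < rhoAP) (hrhoAP' : rhoAP < 1)
    (hlamE : 0 < lamE) (hPs : 0 < Ps) (hPap : 0 < Pap) (halpha : 2 < alpha)
    (X : Proc → Ω → ℕ → Plane) (h : Channel 1 → Ω → ℂ)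
    (hnet : IsSensorNetwork P 1 lamS rhoS lamAP rhoAP lamE X h) :
    (∀ᵐ ω ∂P, sinrAP alpha (Pap / Ps) 0 X h ω < ⊤ ∧ sinrEve alpha (Pap / Ps) 0 X h ω < ⊤) ∧
    Integrable (secrecyRate alpha (Pap / Ps) 0 X h) P ∧
    IntegrableOn (secrecyIntegrand lamS rhoS lamAP rhoAP lamE (Pap / Ps) alpha) (Set.Ioi 0) ∧
    ∫ ω, secrecyRate alpha (Pap / Ps) 0 X h ω ∂P =
      1 / Real.log 2 * ∫ x in Set.Ioi (0 : ℝ),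
        sinrCDF P (sinrEve alpha (Pap / Ps) 0 X h) x / (1 + x) *
          (1 - sinrCDF P (sinrAP alpha (Pap / Ps) 0 X h) x) ∧
    1 / Real.log 2 * ∫ x in Set.Ioi (0 : ℝ),
        sinrCDF P (sinrEve alpha (Pap / Ps) 0 X h) x / (1 + x) *
          (1 - sinrCDF P (sinrAP alpha (Pap / Ps) 0 X h) x) =
      Real.pi * lamAP * (1 - rhoAP) / Real.log 2 * ∫ x in Set.Ioi (0 : ℝ),
        secrecyIntegrand lamS rhoS lamAP rhoAP lamE (Pap / Ps) alpha x := by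
  have hmu : 0 < Pap / Ps := div_pos hPap hPs
  set mu := Pap / Ps
  have hpi := Real.pi_pos
  have hln : 0 < Real.log 2 := Real.log_pos one_lt_two
  have hL : 0 < Lambda1 lamS rhoS lamAP rhoAP mu alpha :=
    Lambda1_pos hlamS hrhoS hlamAP hrhoAP halpha hmu
  have hK : 0 < Real.pi * lamAP * (1 - rhoAP) := mul_pos (by positivity) (by linarith)
  have hI := integrableOn_secrecyIntegrand hlamS hrhoS hlamAP hrhoAP hrhoAP' hlamE halpha hmu
  have hclosed : 1 / Real.log 2 * ∫ x in Set.Ioi (0 : ℝ),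
        sinrCDF P (sinrEve alpha mu 0 X h) x / (1 + x) *
          (1 - sinrCDF P (sinrAP alpha mu 0 X h) x) =
      Real.pi * lamAP * (1 - rhoAP) / Real.log 2 * ∫ x in Set.Ioi (0 : ℝ),
        secrecyIntegrand lamS rhoS lamAP rhoAP lamE mu alpha x := by
    have hcongr : ∀ x ∈ Set.Ioi (0 : ℝ), sinrCDF P (sinrEve alpha mu 0 X h) x / (1 + x) *
        (1 - sinrCDF P (sinrAP alpha mu 0 X h) x) = Real.pi * lamAP * (1 - rhoAP) *
          secrecyIntegrand lamS rhoS lamAP rhoAP lamE mu alpha x := by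
      intro x hx
      have hx : 0 < x := hx
      rw [hnet.one_sub_sinrCDF_sinrAP hlamS hrhoS hlamAP hrhoAP hrhoAP' halpha hmu hx,
        hnet.sinrCDF_sinrEve hlamS hrhoS hlamAP hrhoAP hlamE halpha hmu hx, secrecyIntegrand]
      field_simp
    rw [setIntegral_congr_fun measurableSet_Ioi hcongr, integral_const_mul]
    ring
  set G : Ω → ℝ := fun ω => max (Real.log (1 + (sirAP alpha mu X h ω).toReal) -
      Real.log (1 + (sirEve alpha mu X h ω).toReal)) 0 with hG
  have hGm : Measurable G := by
    have hmA := hnet.measurable_sirAP alpha mu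
    have hmE := hnet.measurable_sirEve alpha mu
    fun_prop
  have hG0 : 0 ≤ᵐ[P] G := .of_forall fun ω => le_max_right _ _
  have hGl := hnet.lintegral_log_sirAP_sub_log_sirEve hlamS hrhoS hlamAP hrhoAP hrhoAP' hlamE
    halpha hmu
  have hGi : Integrable G P := by
    refine ⟨hGm.aestronglyMeasurable, ?_⟩
    rw [hasFiniteIntegral_iff_ofReal hG0, hGl]
    exact ENNReal.ofReal_lt_top
  have hint0 : 0 ≤ ∫ x in Set.Ioi (0 : ℝ),
      secrecyIntegrand lamS rhoS lamAP rhoAP lamE mu alpha x := by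
    refine setIntegral_nonneg measurableSet_Ioi fun x hx => ?_
    have hx : 0 < x := hx
    simp only [secrecyIntegrand]
    positivity
  have hGint : ∫ ω, G ω ∂P = Real.pi * lamAP * (1 - rhoAP) * ∫ x in Set.Ioi (0 : ℝ),
      secrecyIntegrand lamS rhoS lamAP rhoAP lamE mu alpha x := by
    rw [integral_eq_lintegral_of_nonneg_ae hG0 hGm.aestronglyMeasurable, hGl,
      ENNReal.toReal_ofReal (by positivity)]
  have hrate := hnet.secrecyRate_ae_eq (alpha := alpha) (mu := mu)
  refine ⟨?_, (hGi.const_mul _).congr hrate.symm, hI, ?_, hclosed⟩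
  · filter_upwards [hnet.sinrAP_ae_eq alpha mu, hnet.sinrEve_ae_eq alpha mu,
      hnet.ae_sirAP_lt_top hlamS hrhoS hlamAP hrhoAP hrhoAP' halpha hmu,
      hnet.ae_sirEve_lt_top hlamS hrhoS hlamAP hrhoAP hlamE halpha hmu] with ω h1 h2 h3 h4
    rw [h1, h2]
    exact ⟨h3, h4⟩
  · rw [hclosed, integral_congr_ae hrate, integral_const_mul, hGint]
    ring
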